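/- Let $\mathbb K=\mathbb R$ or $\mathbb C$, let $m,r\ge 0$ be integers and let $\alpha^j,\beta^j,\gamma^j$ ($j=1,\dots,m$), $\delta,\varepsilon\in\mathbb K$ be constants. Define the polynomials $h^{(i)}_n$ in variables $u_k$, $k\in\mathbb Z$, by $h^{(0)}_n=\tfrac12$ and $$h^{(i+1)}_n=u_n\sum_{s=0}^i(h^{(s)}_{n+1}+h^{(s)}_n)(h^{(i-s)}_n+h^{(i-s)}_{n-1})-\sum_{s=1}^i h^{(s)}_nh^{(i+1-s)}_n ,$$ and the matrices $L_n=\begin{pmatrix}1&-u_n/\lambda\\1&0\end{pmatrix}$, $U^{(i)}_n=\sum_{k=0}^{i-1}\lambda^{i-1-k}H^{(k)}_n$ for $i\ge1$, where $$H^{(k)}_n=\begin{pmatrix}h^{(k+1)}_n&-u_n(h^{(k)}_{n+1}+h^{(k)}_n)\\ \lambda(h^{(k)}_n+h^{(k)}_{n-1})&-\lambda(h^{(k)}_n+h^{(k)}_{n-1})+h^{(k+1)}_{n-1}\end{pmatrix}.$$ Put $Q^j_n=\alpha^j(y^j_n)^2+(-1)^n\beta^jy^j_n+\gamma^j$ and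 consider functions $u_n,y^j_n$ ($n\in\mathbb Z$) of $(t_1,\dots,t_r)$ in an open set $\Omega\subseteq\mathbb K^r$ such that $y^j_n+y^j_{n-1}\neq0$ everywhere on $\Omega$. (a) Suppose that for all $n$ and $j$ $$u_n(y^j_{n+1}+y^j_n)(y^j_n+y^j_{n-1})=Q^j_n,\qquad 2\sum_{i=1}^r it_ih^{(i)}_n+n-\delta+(-1)^n\varepsilon=y^1_n+\dots+y^m_n \qquad (1)$$ on $\Omega$, and that the flows $u_{n,t_i}=u_n(h^{(i)}_{n+1}-h^{(i)}_{n-1})$, $y^j_{n,t_i}=h^{(i)}_{n,\xi^j}$ hold on $\Omega$ for $i=1,\dots,r$, where $h^{(i)}_{n,\xi^j}$ is the derivative of the polynomial $h^{(i)}_n$ along $u_{k,\xi^j}=u_k(y^j_{k+1}-y^j_{k-1})$. Then the matrices $$W_n=2\sum_{i=1}^r it_iU^{(i)}_n+\sum_{j=1}^m\frac{W^j_n}{\lambda-\alpha^j},\qquad W^j_n=\begin{pmatrix}\alpha^jy^j_n+(-1)^n\frac{\beta^j}2&-\dfrac{Q^j_n}{y^j_n+y^j_{n-1}}\\ \lambda(y^j_n+y^j_{n-1})&-\lambda(y^j_n+y^j_{n-1})+\alpha^jy^j_{n-1}-(-1)^n\frac{\beta^j}2\end{pmatrix}$$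 satisfy on $\Omega$, for all $n$, all $i=1,\dots,r$ and all $\lambda\ne0,\alpha^1,\dots,\alpha^m$, the equations of an isomonodromic Lax pair $$2\lambda L_{n,\lambda}=W_{n+1}L_n-L_nW_n,\qquad W_{n,t_i}=2\lambda U^{(i)}_{n,\lambda}+[U^{(i)}_n,W_n].\qquad(2)$$ (b) Let $r=2$, $x=t_1$, $t=t_2$, and let $$\widetilde W_n=\begin{pmatrix}4t\lambda u_n-n-1-(-1)^n\varepsilon&4tu_n(u_{n-1}-\lambda)+n-\delta+(-1)^n\varepsilon\\ 4t\lambda(\lambda+u_n+u_{n-1})+2\lambda x&-4t\lambda(u_n+\lambda)-2x\lambda-n+(-1)^n\varepsilon\end{pmatrix}+\sum_{j=1}^m\frac{\widetilde W^j_n}{\lambda-\alpha^j},$$ $$\widetilde W^j_n=\begin{pmatrix}\lambda y^j_n+(-1)^n\frac{\beta^j}2&-(\lambda-\alpha^j)y^j_n-\dfrac{Q^j_n}{y^j_n+y^j_{n-1}}\\ \lambda(y^j_n+y^j_{n-1})&-\lambda y^j_n-(-1)^n\frac{\beta^j}2\end{pmatrix}.$$ This is the result of eliminating $u_{n-2}$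 and $u_{n+1}$ from $W_n$, up to a constant scalar matrix: whenever $$4tu_n(u_{n+1}+u_n+u_{n-1})+2xu_n+n-\delta+(-1)^n\varepsilon=y^1_n+\dots+y^m_n\quad\text{for all } n,\qquad(3)$$ one has $W_n=\widetilde W_n+(1+\delta)I$ for all $n$ (and all $\lambda\ne\alpha^1,\dots,\alpha^m$). (c) Let $r=2$, let $\alpha^1,\dots,\alpha^m$ be pairwise distinct, and let $u_n,y^j_n$ be $C^1$ functions of $(x,t)$ on an open set $\Omega\subseteq\mathbb K^2$ with $y^j_n+y^j_{n-1}\ne0$ on $\Omega$. Then equations (2) with $\widetilde W_n$ instead of $W_n$ (for all $n$, $i=1,2$ and $\lambda\ne0,\alpha^1,\dots,\alpha^m$, on $\Omega$) are equivalent to the following equations, for all $n$ and $j$ on $\Omega$: the first equation of (1), equation (3), and $$u_{n,x}=u_n(u_{n+1}-u_{n-1}),\qquad y^j_{n,x}=u_n(y^j_{n+1}-y^j_{n-1}),$$ $$u_{n,t}=u_n\bigl(u_{n+1}(u_{n+2}+u_{n+1}+u_n)-u_{n-1}(u_n+u_{n-1}+u_{n-2})\bigr),$$ $$y^j_{n,t}=u_n\bigl(u_{n+1}(y^j_{n+2}-y^j_n)+(u_{n+1}+2u_n+u_{n-1})(y^j_{n+1}-y^j_{n-1})+u_{n-1}(y^j_n-y^j_{n-2})\bigr).$$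 -/

import Mathlib

open scoped Matrix

noncomputable section

namespace Volterra

/-- The constants of the reduction: `α^j, β^j, γ^j` (`j = 1, …, m`), `δ` and `ε`. -/
structure Params (𝕜 : Type*) (m : ℕ) where
  α : Fin m → 𝕜
  β : Fin m → 𝕜
  γ : Fin m → 𝕜
  δ : 𝕜
  ε : 𝕜

/-- The homogeneous polynomials `h^{(i)}_n` in the variables `u_k`, `k ∈ ℤ`:
`h^{(0)}_n = 1/2` and
`h^{(i+1)}_n = u_n ∑_{s=0}^{i} (h^{(s)}_{n+1} + h^{(s)}_n) (h^{(i-s)}_n + h^{(i-s)}_{n-1})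
  - ∑_{s=1}^{i} h^{(s)}_n h^{(i+1-s)}_n`. In the last sum the index `s` is shifted by one. -/
def hPoly (𝕜 : Type*) [Field 𝕜] : ℕ → ℤ → MvPolynomial ℤ 𝕜
  | 0, _ => MvPolynomial.C (1 / 2)
  | i + 1, n =>
      MvPolynomial.X n *
          ∑ s : Fin (i + 1),
            (hPoly 𝕜 s.val (n + 1) + hPoly 𝕜 s.val n) *
              (hPoly 𝕜 (i - s.val) n + hPoly 𝕜 (i - s.val) (n - 1))
        - ∑ s : Fin i, hPoly 𝕜 (s.val + 1) n * hPoly 𝕜 (i - s.val) n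
  termination_by i => i
  decreasing_by all_goals omega

variable {𝕜 : Type*}

/-- The value of `h^{(i)}_n` on a sequence `u`. -/
def h [Field 𝕜] (i : ℕ) (n : ℤ) (u : ℤ → 𝕜) : 𝕜 :=
  MvPolynomial.eval u (hPoly 𝕜 i n)

/-- The derivative `h^{(i)}_{n,ξ}` of `h^{(i)}_n` along the flow
`u_{k,ξ} = u_k (y_{k+1} - y_{k-1})`, computed by the chain rule. -/
def hXi [Field 𝕜] (i : ℕ) (n : ℤ) (u y : ℤ → 𝕜) : 𝕜 :=
  ∑ k ∈ (hPoly 𝕜 i n).vars,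
    MvPolynomial.eval u (MvPolynomial.pderiv k (hPoly 𝕜 i n)) * (u k * (y (k + 1) - y (k - 1)))

/-- The matrix `L_n` with spectral parameter `z`. -/
def L [Field 𝕜] (u : ℤ → 𝕜) (n : ℤ) (z : 𝕜) : Matrix (Fin 2) (Fin 2) 𝕜 :=
  !![1, -u n / z;
     1, 0]

/-- The matrix `H^{(i)}_n`. -/
def H [Field 𝕜] (i : ℕ) (u : ℤ → 𝕜) (n : ℤ) (z : 𝕜) : Matrix (Fin 2) (Fin 2) 𝕜 :=
  !![h (i + 1) n u, -u n * (h i (n + 1) u + h i n u);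
     z * (h i n u + h i (n - 1) u), -z * (h i n u + h i (n - 1) u) + h (i + 1) (n - 1) u]

/-- The matrix `U^{(i)}_n = z^{i-1} H^{(0)}_n + z^{i-2} H^{(1)}_n + ⋯ + H^{(i-1)}_n`, `i ≥ 1`. -/
def U [Field 𝕜] (i : ℕ) (u : ℤ → 𝕜) (n : ℤ) (z : 𝕜) : Matrix (Fin 2) (Fin 2) 𝕜 :=
  ∑ k ∈ Finset.range i, z ^ (i - 1 - k) • H k u n z

/-- The right hand side `α^j y^2 + (-1)^n β^j y + γ^j`. -/
def quad [Field 𝕜] {m : ℕ} (p : Params 𝕜 m) (j : Fin m) (n : ℤ) (v : 𝕜) : 𝕜 :=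
  p.α j * v ^ 2 + (-1) ^ n * p.β j * v + p.γ j

/-- The matrix `W^j_n` of the general case. -/
def Wj [Field 𝕜] {m : ℕ} (p : Params 𝕜 m) (j : Fin m) (y : Fin m → ℤ → 𝕜) (n : ℤ) (z : 𝕜) :
    Matrix (Fin 2) (Fin 2) 𝕜 :=
  !![p.α j * y j n + (-1) ^ n * (p.β j / 2), -(quad p j n (y j n) / (y j n + y j (n - 1)));
     z * (y j n + y j (n - 1)),
       -z * (y j n + y j (n - 1)) + p.α j * y j (n - 1) - (-1) ^ n * (p.β j / 2)]

/-- The matrix `W_n = 2 ∑_{i=1}^r i t_i U^{(i)}_n + ∑_{j=1}^m W^j_n / (z - α^j)`.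
The time `t_i` is the coordinate `t (i-1)` of the vector `t : Fin r → 𝕜`. -/
def W [Field 𝕜] {r m : ℕ} (p : Params 𝕜 m) (t : Fin r → 𝕜) (u : ℤ → 𝕜) (y : Fin m → ℤ → 𝕜)
    (n : ℤ) (z : 𝕜) : Matrix (Fin 2) (Fin 2) 𝕜 :=
  (2 : 𝕜) • ∑ i : Fin r, (((i.val + 1 : ℕ) : 𝕜) * t i) • U (i.val + 1) u n z
    + ∑ j : Fin m, (1 / (z - p.α j)) • Wj p j y n z

/-- The first `m` equations of the system:
`u_n (y^j_{n+1} + y^j_n)(y^j_n + y^j_{n-1}) = α^j (y^j_n)^2 + (-1)^n β^j y^j_n + γ^j`, `n ∈ ℤ`. -/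
def YEquations [Field 𝕜] {m : ℕ} (p : Params 𝕜 m) (u : ℤ → 𝕜) (y : Fin m → ℤ → 𝕜) : Prop :=
  ∀ (j : Fin m) (n : ℤ),
    u n * (y j (n + 1) + y j n) * (y j n + y j (n - 1)) = quad p j n (y j n)

/-- The last equation of the system:
`2 ∑_{i=1}^r i t_i h^{(i)}_n + n - δ + (-1)^n ε = y^1_n + ⋯ + y^m_n`, `n ∈ ℤ`. -/
def Constraint [Field 𝕜] {r m : ℕ} (p : Params 𝕜 m) (t : Fin r → 𝕜) (u : ℤ → 𝕜)
    (y : Fin m → ℤ → 𝕜) : Prop :=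
  ∀ n : ℤ,
    2 * ∑ i : Fin r, ((i.val + 1 : ℕ) : 𝕜) * t i * h (i.val + 1) n u
      + (n : 𝕜) - p.δ + (-1) ^ n * p.ε = ∑ j : Fin m, y j n

/-- The last equation of the system with the two times `x = t_1`, `t = t_2`:
`4 t u_n (u_{n+1} + u_n + u_{n-1}) + 2 x u_n + n - δ + (-1)^n ε = y^1_n + ⋯ + y^m_n`. -/
def ConstraintXT [Field 𝕜] {m : ℕ} (p : Params 𝕜 m) (x t : 𝕜) (u : ℤ → 𝕜)
    (y : Fin m → ℤ → 𝕜) : Prop :=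
  ∀ n : ℤ,
    4 * t * u n * (u (n + 1) + u n + u (n - 1)) + 2 * x * u n
      + (n : 𝕜) - p.δ + (-1) ^ n * p.ε = ∑ j : Fin m, y j n

/-- The matrix `W_n` for `r = 2` after the elimination of `u_{n-2}` and `u_{n+1}`. -/
def WXT [Field 𝕜] {m : ℕ} (p : Params 𝕜 m) (x t : 𝕜) (u : ℤ → 𝕜) (y : Fin m → ℤ → 𝕜)
    (n : ℤ) (z : 𝕜) : Matrix (Fin 2) (Fin 2) 𝕜 :=
  !![4 * t * z * u n - n - 1 - (-1) ^ n * p.ε,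
      4 * t * u n * (u (n - 1) - z) + n - p.δ + (-1) ^ n * p.ε;
     4 * t * z * (z + u n + u (n - 1)) + 2 * z * x,
      -4 * t * z * (u n + z) - 2 * x * z - n + (-1) ^ n * p.ε]
  + ∑ j : Fin m, (1 / (z - p.α j)) •
    !![z * y j n + (-1) ^ n * (p.β j / 2),
        -(z - p.α j) * y j n - quad p j n (y j n) / (y j n + y j (n - 1));
       z * (y j n + y j (n - 1)),
        -z * y j n - (-1) ^ n * (p.β j / 2)]

/-- `f` has at `τ` the partial derivative `f'` with respect to the coordinate `i`. -/
def HasPartialDerivAt [RCLike 𝕜] {r : ℕ} (f : (Fin r → 𝕜) → 𝕜) (f' : 𝕜) (i : Fin r)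
    (τ : Fin r → 𝕜) : Prop :=
  HasDerivAt (fun s : 𝕜 => f (Function.update τ i s)) f' (τ i)

/-- Entrywise derivative of a matrix with respect to the spectral parameter. -/
def specDeriv [RCLike 𝕜] (F : 𝕜 → Matrix (Fin 2) (Fin 2) 𝕜) (z : 𝕜) :
    Matrix (Fin 2) (Fin 2) 𝕜 :=
  Matrix.of fun a b => deriv (fun s : 𝕜 => F s a b) z

/-- The derivations `D_1, …, D_r` on the domain `Ω`:
`u_{n,t_i} = u_n (h^{(i)}_{n+1} - h^{(i)}_{n-1})` and `y^j_{n,t_i} = h^{(i)}_{n,ξ^j}`,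
where `u_{n,ξ^j} = u_n (y^j_{n+1} - y^j_{n-1})`. -/
def Flows [RCLike 𝕜] {r m : ℕ} (Ω : Set (Fin r → 𝕜)) (u : (Fin r → 𝕜) → ℤ → 𝕜)
    (y : (Fin r → 𝕜) → Fin m → ℤ → 𝕜) : Prop :=
  ∀ τ ∈ Ω, ∀ (i : Fin r) (n : ℤ),
    HasPartialDerivAt (fun σ => u σ n)
        (u τ n * (h (i.val + 1) (n + 1) (u τ) - h (i.val + 1) (n - 1) (u τ))) i τ
      ∧ ∀ j : Fin m,
        HasPartialDerivAt (fun σ => y σ j n) (hXi (i.val + 1) n (u τ) (y τ j)) i τ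

/-- The explicit `x`- and `t`-flows of `u_n` and `y^j_n` on the domain `Ω`, where `x` and `t`
are the first and the second coordinate. -/
def FlowsXT [RCLike 𝕜] {m : ℕ} (Ω : Set (Fin 2 → 𝕜)) (u : (Fin 2 → 𝕜) → ℤ → 𝕜)
    (y : (Fin 2 → 𝕜) → Fin m → ℤ → 𝕜) : Prop :=
  ∀ τ ∈ Ω, ∀ n : ℤ,
    HasPartialDerivAt (fun σ => u σ n) (u τ n * (u τ (n + 1) - u τ (n - 1))) 0 τ
    ∧ HasPartialDerivAt (fun σ => u σ n)
        (u τ n * (u τ (n + 1) * (u τ (n + 2) + u τ (n + 1) + u τ n)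
          - u τ (n - 1) * (u τ n + u τ (n - 1) + u τ (n - 2)))) 1 τ
    ∧ ∀ j : Fin m,
      HasPartialDerivAt (fun σ => y σ j n) (u τ n * (y τ j (n + 1) - y τ j (n - 1))) 0 τ
      ∧ HasPartialDerivAt (fun σ => y σ j n)
          (u τ n * (u τ (n + 1) * (y τ j (n + 2) - y τ j n)
            + (u τ (n + 1) + 2 * u τ n + u τ (n - 1)) * (y τ j (n + 1) - y τ j (n - 1))
            + u τ (n - 1) * (y τ j n - y τ j (n - 2)))) 1 τ

/-- The matrix equations
`2 z L_{n,z} = W_{n+1} L_n - L_n W_n` and `W_{n,t_i} = 2 z U^{(i)}_{n,z} + [U^{(i)}_n, W_n]`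
for a given matrix `V` in the role of `W`, on the domain `Ω`, for all `n`, all `i = 1, …, r` and
all values `z` of the spectral parameter at which the matrices are defined. The derivatives
`W_{n,t_i}` exist as a part of the statement. -/
def LaxEquations [RCLike 𝕜] {r m : ℕ} (p : Params 𝕜 m) (Ω : Set (Fin r → 𝕜))
    (u : (Fin r → 𝕜) → ℤ → 𝕜)
    (V : (Fin r → 𝕜) → ℤ → 𝕜 → Matrix (Fin 2) (Fin 2) 𝕜) : Prop :=
  ∀ τ ∈ Ω, ∀ (n : ℤ) (z : 𝕜), z ≠ 0 → (∀ j, z ≠ p.α j) →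
    (2 * z) • specDeriv (fun s => L (u τ) n s) z
        = V τ (n + 1) z * L (u τ) n z - L (u τ) n z * V τ n z
    ∧ ∀ (i : Fin r) (a b : Fin 2),
      HasPartialDerivAt (fun σ => V σ n z a b)
        (((2 * z) • specDeriv (fun s => U (i.val + 1) (u τ) n s) z
          + (U (i.val + 1) (u τ) n z * V τ n z - V τ n z * U (i.val + 1) (u τ) n z)) a b) i τ

end Volterra

end

noncomputable section

namespace Volterra

variable {𝕜 : Type*}

/-! Call (a, b) a Lenard pair if b_{n+1} - b_n = u_{n+1}(a_{n+2} + a_{n+1}) - u_n(a_n + a_{n-1}).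
The series h_n = ∑ h^{(i)}_n X^i, with X in the role of 1/λ, satisfies h_n² = 1/4 + X u_n (h_{n+1} +
h_n)(h_n + h_{n-1}). Subtracting neighbouring relations shows that (h^{(k)}, h^{(k+1)}) is a Lenard
pair. The same subtraction in the y^j equations makes (y^j, α^j y^j + (-1)^n β^j/2) one. Hence
H^{(k)} and W^j are instances of a single matrix M(a, b), `lenardMatrix`, and one computation serves
both.

Let ∂_a be the derivative along u_k(a_{k+1} - a_{k-1}). For a Lenard pair, `LenardPair.dh_sub`
evaluates ∂_b h^{(k)} - ∂_a h^{(k+1)}, because the linearised quadratic relation has a unique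
solution. This gives [U^{(i)}, M(a, b)] in `LenardPair.commutator_U`. For the pairs built from h it
is the zero curvature relation. For y^j, where ∂_b = α^j ∂_a, it is the derivative of W^j plus a
term with the factor λ - α^j, which cancels the pole. Homogeneity expresses λ U_λ through the
derivative of U along u itself. Differencing the last equation of (1) gives 2u + 2∑ i t_i u_{t_i} =
∑ u_{ξ^j} (`Constraint.flow_eq`), and with it all surplus terms in (2) cancel.

For the converse in (c), one entry of each matrix equation is decomposed into partial fractions in
λ. The first equation gives the y^j equations as residues and (3) as the regular part. The second
gives the y^j flows as residues and, multiplied by 4t, the u flow. The factor t is removed by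
continuity of the derivatives of u. -/

open Finset in
/-- The recurrence of the polynomials `hPoly` in convolution form. -/
theorem hPoly_convolution [Field 𝕜] [CharZero 𝕜] (i : ℕ) (n : ℤ) :
    ∑ x ∈ antidiagonal (i + 1), hPoly 𝕜 x.1 n * hPoly 𝕜 x.2 n =
      MvPolynomial.X n * ∑ x ∈ antidiagonal i,
        (hPoly 𝕜 x.1 (n + 1) + hPoly 𝕜 x.1 n) * (hPoly 𝕜 x.2 n + hPoly 𝕜 x.2 (n - 1)) := by
  have h0 : hPoly 𝕜 0 n = MvPolynomial.C (1 / 2) := by rw [hPoly]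
  have h1 : hPoly 𝕜 (i + 1) n =
      MvPolynomial.X n * ∑ x ∈ antidiagonal i,
        (hPoly 𝕜 x.1 (n + 1) + hPoly 𝕜 x.1 n) * (hPoly 𝕜 x.2 n + hPoly 𝕜 x.2 (n - 1))
      - ∑ s ∈ range i, hPoly 𝕜 (s + 1) n * hPoly 𝕜 (i - s) n := by
    rw [hPoly, Nat.sum_antidiagonal_eq_sum_range_succ_mk, sum_range, sum_range]
  -- The two end terms of the convolution each equal h^{(i+1)}/2, so together they supply the left
  -- side of the recurrence.
  have h2 : (MvPolynomial.C (1 / 2) : MvPolynomial ℤ 𝕜) + MvPolynomial.C (1 / 2) = 1 := by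
    rw [← MvPolynomial.C_add, add_halves, MvPolynomial.C_1]
  rw [Nat.sum_antidiagonal_eq_sum_range_succ_mk, sum_range_succ, sum_range_succ', h0]
  simp only [Nat.add_sub_add_right, Nat.sub_self, Nat.sub_zero, h0]
  linear_combination h1 + hPoly 𝕜 (i + 1) n * h2

/-- The derivative of a polynomial along `v`, evaluated at `u`. -/
def dirDeriv [Field 𝕜] (u v : ℤ → 𝕜) (f : MvPolynomial ℤ 𝕜) : 𝕜 :=
  MvPolynomial.eval u (MvPolynomial.mkDerivation 𝕜 (fun k => MvPolynomial.C (v k)) f)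

/-! ### Directional derivatives of polynomials in the u_k. -/

section dirDeriv

variable [Field 𝕜] (u v w : ℤ → 𝕜)

/-- Links the chain-rule sum to a derivation, for which the Leibniz rule is available: two
derivations that agree on the variables of f agree on f. -/
theorem dirDeriv_eq_sum (f : MvPolynomial ℤ 𝕜) :
    dirDeriv u v f =
      ∑ k ∈ f.vars, MvPolynomial.eval u (MvPolynomial.pderiv k f) * v k := by
  have key : MvPolynomial.mkDerivation 𝕜 (fun k => MvPolynomial.C (v k)) f =
      (∑ k ∈ f.vars, MvPolynomial.C (σ := ℤ) (v k) • MvPolynomial.pderiv (R := 𝕜) k) f := by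
    apply MvPolynomial.derivation_eq_of_forall_mem_vars
    intro i hi
    rw [MvPolynomial.mkDerivation_X, ← Derivation.coeFnAddMonoidHom_apply, map_sum,
      Finset.sum_apply, Finset.sum_eq_single i]
    · simp [Derivation.coeFnAddMonoidHom_apply]
    · intro j _ hj
      simp [Derivation.coeFnAddMonoidHom_apply, MvPolynomial.pderiv_X_of_ne hj.symm]
    · exact fun h => absurd hi h
  rw [dirDeriv, key, ← Derivation.coeFnAddMonoidHom_apply, map_sum, Finset.sum_apply, map_sum]
  refine Finset.sum_congr rfl fun k _ => ?_
  simp [Derivation.coeFnAddMonoidHom_apply, mul_comm]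

theorem dirDeriv_X (k : ℤ) : dirDeriv u v (MvPolynomial.X k) = v k := by
  simp [dirDeriv, MvPolynomial.mkDerivation_X]

theorem dirDeriv_C (c : 𝕜) : dirDeriv u v (MvPolynomial.C c) = 0 := by
  simp [dirDeriv]

theorem dirDeriv_add (f g : MvPolynomial ℤ 𝕜) :
    dirDeriv u v (f + g) = dirDeriv u v f + dirDeriv u v g := by
  simp [dirDeriv]

theorem dirDeriv_sum {ι : Type*} (s : Finset ι) (f : ι → MvPolynomial ℤ 𝕜) :
    dirDeriv u v (∑ i ∈ s, f i) = ∑ i ∈ s, dirDeriv u v (f i) := by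
  simp [dirDeriv, map_sum]

theorem dirDeriv_mul (f g : MvPolynomial ℤ 𝕜) :
    dirDeriv u v (f * g) =
      MvPolynomial.eval u f * dirDeriv u v g + MvPolynomial.eval u g * dirDeriv u v f := by
  simp [dirDeriv, Derivation.leibniz]

theorem dirDeriv_add_right (f : MvPolynomial ℤ 𝕜) :
    dirDeriv u (v + w) f = dirDeriv u v f + dirDeriv u w f := by
  simp [dirDeriv_eq_sum, mul_add, Finset.sum_add_distrib]

theorem dirDeriv_smul_right (c : 𝕜) (f : MvPolynomial ℤ 𝕜) :
    dirDeriv u (c • v) f = c * dirDeriv u v f := by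
  simp [dirDeriv_eq_sum, Finset.mul_sum, mul_left_comm]

end dirDeriv

/-- The derivative of `h^{(i)}_n` along `v`. -/
def dh [Field 𝕜] (i : ℕ) (n : ℤ) (u v : ℤ → 𝕜) : 𝕜 := dirDeriv u v (hPoly 𝕜 i n)

/-- The vector field `u_k (a_{k+1} - a_{k-1})`. -/
def flow [Field 𝕜] (u a : ℤ → 𝕜) (k : ℤ) : 𝕜 := u k * (a (k + 1) - a (k - 1))

theorem hXi_eq_dh [Field 𝕜] (i : ℕ) (n : ℤ) (u y : ℤ → 𝕜) :
    hXi i n u y = dh i n u (flow u y) := by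
  rw [dh, dirDeriv_eq_sum]; rfl

/-- The generating series of the values `h^{(i)}_n`. -/
def hSeries [Field 𝕜] (u : ℤ → 𝕜) (n : ℤ) : PowerSeries 𝕜 := PowerSeries.mk fun i => h i n u

/-- The generating series of the derivatives of `h^{(i)}_n` along `v`. -/
def dSeries [Field 𝕜] (u v : ℤ → 𝕜) (n : ℤ) : PowerSeries 𝕜 :=
  PowerSeries.mk fun i => dh i n u v

/-! ### Generating series and Lenard pairs. -/

section series

variable [Field 𝕜] [CharZero 𝕜] (u v : ℤ → 𝕜)

omit [CharZero 𝕜] in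
@[simp] theorem h_zero (n : ℤ) : h 0 n u = 1 / 2 := by
  rw [h, hPoly, MvPolynomial.eval_C]

omit [CharZero 𝕜] in
@[simp] theorem dh_zero (n : ℤ) : dh 0 n u v = 0 := by
  rw [dh, hPoly, dirDeriv_C]

open Finset in
theorem h_convolution (i : ℕ) (n : ℤ) :
    ∑ x ∈ antidiagonal (i + 1), h x.1 n u * h x.2 n u =
      u n * ∑ x ∈ antidiagonal i,
        (h x.1 (n + 1) u + h x.1 n u) * (h x.2 n u + h x.2 (n - 1) u) := by
  have := congrArg (MvPolynomial.eval u) (hPoly_convolution (𝕜 := 𝕜) i n)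
  simpa [map_sum, h] using this

open Finset in
theorem dh_convolution (i : ℕ) (n : ℤ) :
    2 * ∑ x ∈ antidiagonal (i + 1), h x.1 n u * dh x.2 n u v =
      v n * ∑ x ∈ antidiagonal i,
        (h x.1 (n + 1) u + h x.1 n u) * (h x.2 n u + h x.2 (n - 1) u) +
      u n * (∑ x ∈ antidiagonal i,
          (dh x.1 (n + 1) u v + dh x.1 n u v) * (h x.2 n u + h x.2 (n - 1) u) +
        ∑ x ∈ antidiagonal i,
          (h x.1 (n + 1) u + h x.1 n u) * (dh x.2 n u v + dh x.2 (n - 1) u v)) := by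
  have := congrArg (dirDeriv u v) (hPoly_convolution (𝕜 := 𝕜) i n)
  simp only [dirDeriv_sum, dirDeriv_mul, dirDeriv_add, dirDeriv_X, map_sum, map_mul, map_add,
    MvPolynomial.eval_X, Finset.sum_add_distrib] at this
  have sw : ∑ x ∈ antidiagonal (i + 1), h x.2 n u * dh x.1 n u v =
      ∑ x ∈ antidiagonal (i + 1), h x.1 n u * dh x.2 n u v := by
    rw [← Finset.Nat.sum_antidiagonal_swap]; rfl
  simp only [h, dh] at *
  rw [sw] at this
  rw [two_mul, this, mul_comm (v n), add_comm]
  congr 2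
  rw [add_comm]
  congr 1
  exact Finset.sum_congr rfl fun x _ => mul_comm _ _

theorem hSeries_sq (n : ℤ) :
    hSeries u n * hSeries u n = PowerSeries.C (1 / 4) + PowerSeries.X * (PowerSeries.C (u n) *
      ((hSeries u (n + 1) + hSeries u n) * (hSeries u n + hSeries u (n - 1)))) := by
  ext i
  cases i with
  | zero => simp [PowerSeries.coeff_mul, hSeries]; norm_num
  | succ i =>
    rw [map_add, PowerSeries.coeff_succ_X_mul, PowerSeries.coeff_C_mul, PowerSeries.coeff_C,
      if_neg (Nat.succ_ne_zero i), zero_add, PowerSeries.coeff_mul, PowerSeries.coeff_mul]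
    simpa [hSeries] using h_convolution u i n

theorem dSeries_sq (n : ℤ) :
    2 * hSeries u n * dSeries u v n = PowerSeries.X * (PowerSeries.C (v n) *
        ((hSeries u (n + 1) + hSeries u n) * (hSeries u n + hSeries u (n - 1)))
      + PowerSeries.C (u n) *
        ((dSeries u v (n + 1) + dSeries u v n) * (hSeries u n + hSeries u (n - 1))
          + (hSeries u (n + 1) + hSeries u n) * (dSeries u v n + dSeries u v (n - 1)))) := by
  have h2 : (2 : PowerSeries 𝕜) = PowerSeries.C 2 := (map_ofNat _ 2).symm
  rw [mul_assoc, h2]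
  ext i
  cases i with
  | zero => simp [dSeries]
  | succ i =>
    rw [PowerSeries.coeff_succ_X_mul, map_add, PowerSeries.coeff_C_mul, PowerSeries.coeff_C_mul,
      PowerSeries.coeff_C_mul, map_add, PowerSeries.coeff_mul, PowerSeries.coeff_mul,
      PowerSeries.coeff_mul, PowerSeries.coeff_mul]
    simpa [hSeries, dSeries] using dh_convolution u v i n

theorem hSeries_ne_zero_add (n : ℤ) : hSeries u (n + 1) + hSeries u n ≠ 0 := by
  intro h0
  have := congrArg (PowerSeries.coeff 0) h0
  simp [hSeries] at this

/-- The quadratic relations at n and n + 1 share the factor h_{n+1} + h_n, whose constant term is 1;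
it cancels from their difference. -/
theorem hSeries_linear (n : ℤ) :
    hSeries u (n + 1) - hSeries u n = PowerSeries.X *
      (PowerSeries.C (u (n + 1)) * (hSeries u (n + 2) + hSeries u (n + 1))
        - PowerSeries.C (u n) * (hSeries u n + hSeries u (n - 1))) := by
  apply mul_left_cancel₀ (hSeries_ne_zero_add u n)
  have h1 := hSeries_sq u n
  have h2 := hSeries_sq u (n + 1)
  rw [show n + 1 + 1 = n + 2 by ring, show n + 1 - 1 = n by ring] at h2
  linear_combination h2 - h1

/-- The linearised quadratic relation has only the zero solution. -/
theorem eq_zero_of_linearised (d : ℤ → PowerSeries 𝕜)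
    (hd : ∀ n, 2 * hSeries u n * d n = PowerSeries.X * (PowerSeries.C (u n) *
        ((d (n + 1) + d n) * (hSeries u n + hSeries u (n - 1))
          + (hSeries u (n + 1) + hSeries u n) * (d n + d (n - 1))))) (n : ℤ) : d n = 0 := by
  -- Since 2h_n is a unit and the right side carries a factor X, divisibility of all d n by X^k
  -- improves to X^(k+1).
  have key : ∀ k n, (PowerSeries.X : PowerSeries 𝕜) ^ k ∣ d n := by
    intro k
    induction k with
    | zero => simp
    | succ k ih =>
      intro n
      have hu : IsUnit (2 * hSeries u n) := by
        rw [PowerSeries.isUnit_iff_constantCoeff]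
        have h2 : PowerSeries.constantCoeff (2 : PowerSeries 𝕜) = 2 := map_ofNat _ 2
        simp [hSeries, h2]
      rw [← hu.dvd_mul_left, hd, pow_succ']
      refine mul_dvd_mul_left _ (Dvd.dvd.mul_left (dvd_add ?_ ?_) _)
      · exact Dvd.dvd.mul_right (dvd_add (ih _) (ih _)) _
      · exact Dvd.dvd.mul_left (dvd_add (ih _) (ih _)) _
  ext i
  exact PowerSeries.X_pow_dvd_iff.1 (key (i + 1) n) i (Nat.lt_succ_self i)

/-- The pairs of sequences related by the Lenard operator of the lattice. -/
def LenardPair {𝕜 : Type*} [Field 𝕜] (u a b : ℤ → 𝕜) : Prop :=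
  ∀ n, b (n + 1) - b n = u (n + 1) * (a (n + 2) + a (n + 1)) - u n * (a n + a (n - 1))

theorem lenardPair_h (k : ℕ) : LenardPair u (fun n => h k n u) (fun n => h (k + 1) n u) := by
  intro n
  have := congrArg (PowerSeries.coeff (k + 1)) (hSeries_linear u n)
  rw [PowerSeries.coeff_succ_X_mul] at this
  simpa [hSeries] using this

-- The difference of the two sides solves the homogeneous linearised relation: the inhomogeneous
-- terms of the two flows cancel by the Lenard relations of (a, b) and of h, each taken at n and n -
-- 1.
variable {u} in
theorem LenardPair.dSeries_eq {a b : ℤ → 𝕜} (hab : LenardPair u a b) (n : ℤ) :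
    PowerSeries.X * dSeries u (flow u b) n - dSeries u (flow u a) n =
      PowerSeries.X * (PowerSeries.C (u n) *
        ((hSeries u (n + 1) + hSeries u n) * PowerSeries.C (a n + a (n - 1))
          - PowerSeries.C (a (n + 1) + a n) * (hSeries u n + hSeries u (n - 1)))) := by
  rw [← sub_eq_zero]
  refine eq_zero_of_linearised u (fun n =>
    PowerSeries.X * dSeries u (flow u b) n - dSeries u (flow u a) n -
      PowerSeries.X * (PowerSeries.C (u n) *
        ((hSeries u (n + 1) + hSeries u n) * PowerSeries.C (a n + a (n - 1))
          - PowerSeries.C (a (n + 1) + a n) * (hSeries u n + hSeries u (n - 1))))) ?_ n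
  intro n
  have l1 := hSeries_linear u n
  have l2 := hSeries_linear u (n - 1)
  have da := dSeries_sq u (flow u a) n
  have db := dSeries_sq u (flow u b) n
  have b1 := congrArg (PowerSeries.C (R := 𝕜)) (hab n)
  have b2 := congrArg (PowerSeries.C (R := 𝕜)) (hab (n - 1))
  simp only [flow, show n - 1 + 2 = n + 1 by ring, show n - 1 + 1 = n by ring,
    show n + 1 + 1 = n + 2 by ring, show n + 1 - 1 = n by ring, map_add, map_sub, map_mul]
    at l1 l2 da db b1 b2 ⊢
  set h0 := hSeries u n
  set h1 := hSeries u (n + 1)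
  set hm := hSeries u (n - 1)
  set X := (PowerSeries.X : PowerSeries 𝕜)
  set U := PowerSeries.C (u n)
  linear_combination X * db - da
    - X * U * (h0 + hm) * ((PowerSeries.C (a (n + 1)) + PowerSeries.C (a n)) * l1
      - X * (h1 + h0) * b1)
    - X * U * (h1 + h0) * ((PowerSeries.C (a n) + PowerSeries.C (a (n - 1))) * l2
      - X * (h0 + hm) * b2)

variable {u} in
/-- The derivatives of `h^{(k)}_n` along the two flows of a Lenard pair. -/
theorem LenardPair.dh_sub {a b : ℤ → 𝕜} (hab : LenardPair u a b) (k : ℕ) (n : ℤ) :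
    dh k n u (flow u b) - dh (k + 1) n u (flow u a) =
      u n * ((h k (n + 1) u + h k n u) * (a n + a (n - 1))
        - (a (n + 1) + a n) * (h k n u + h k (n - 1) u)) := by
  have := congrArg (PowerSeries.coeff (k + 1)) (hab.dSeries_eq n)
  rw [map_sub, PowerSeries.coeff_succ_X_mul, PowerSeries.coeff_succ_X_mul,
    PowerSeries.coeff_C_mul, map_sub, PowerSeries.coeff_mul_C, PowerSeries.coeff_C_mul] at this
  simpa [hSeries, dSeries] using this

omit [CharZero 𝕜] in
theorem flow_h_zero : flow u (fun n => h 0 n u) = 0 := by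
  funext k; simp [flow]

omit [CharZero 𝕜] in
theorem dh_add (w : ℤ → 𝕜) (i : ℕ) (n : ℤ) : dh i n u (v + w) = dh i n u v + dh i n u w :=
  dirDeriv_add_right u v w _

omit [CharZero 𝕜] in
theorem dh_smul (c : 𝕜) (i : ℕ) (n : ℤ) : dh i n u (c • v) = c * dh i n u v :=
  dirDeriv_smul_right u v c _

omit [CharZero 𝕜] in
theorem dh_zero_right (i : ℕ) (n : ℤ) : dh i n u 0 = 0 := by
  simpa using dh_smul u 0 0 i n

omit [CharZero 𝕜] in
theorem dh_sum {ι : Type*} (s : Finset ι) (f : ι → ℤ → 𝕜) (i : ℕ) (n : ℤ) :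
    dh i n u (∑ j ∈ s, f j) = ∑ j ∈ s, dh i n u (f j) := by
  classical
  induction s using Finset.induction_on with
  | empty => simp [dh_zero_right]
  | insert j s hj ih => rw [Finset.sum_insert hj, Finset.sum_insert hj, dh_add, ih]

/-- The derivative of `h^{(k)}_n` along the `i`-th flow is symmetric in `i` and `k`. -/
theorem dh_flow_h_comm (i k : ℕ) (n : ℤ) :
    dh k n u (flow u fun n => h i n u) = dh i n u (flow u fun n => h k n u) := by
  induction i generalizing k with
  | zero => rw [flow_h_zero, dh_zero_right, dh_zero]
  | succ i ih =>
    have e1 := (lenardPair_h u i).dh_sub k n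
    have e2 := (lenardPair_h u k).dh_sub i n
    -- The right sides of `e1` and `e2` are interchanged with opposite sign under i ↔ k, so they
    -- cancel in the sum.
    linear_combination e1 + e2 + ih (k + 1)

/-- The Euler identity: `h^{(i)}_n` is homogeneous of degree `i`. -/
theorem dh_self (i : ℕ) (n : ℤ) : dh i n u u = i * h i n u := by
  -- X d/dX of the series and its derivative along u satisfy the same inhomogeneous linearised
  -- relation.
  have key := eq_zero_of_linearised u
    (fun n => dSeries u u n - PowerSeries.X * PowerSeries.derivative 𝕜 (hSeries u n)) (fun n => by
      have e1 := dSeries_sq u u n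
      have e2 := congrArg (PowerSeries.derivative 𝕜) (hSeries_sq u n)
      simp only [Derivation.leibniz, map_add, PowerSeries.derivative_C, PowerSeries.derivative_X,
        smul_eq_mul] at e2
      linear_combination e1 - PowerSeries.X * e2) n
  have := congrArg (PowerSeries.coeff i) key
  cases i with
  | zero => simp
  | succ i =>
    rw [map_sub, PowerSeries.coeff_succ_X_mul, PowerSeries.coeff_derivative] at this
    simp only [dSeries, hSeries, PowerSeries.coeff_mk, map_zero] at this
    push_cast
    linear_combination this
end series

/-! ### Matrices of Lenard pairs and their commutators. -/

section matrices

variable [Field 𝕜]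

/-- The common form of the matrices `H`, `U` and `Wj`. -/
def lenardMatrix (u a b : ℤ → 𝕜) (n : ℤ) (z : 𝕜) : Matrix (Fin 2) (Fin 2) 𝕜 :=
  !![b n, -u n * (a (n + 1) + a n);
     z * (a n + a (n - 1)), -z * (a n + a (n - 1)) + b (n - 1)]

/-- The derivative of `lenardMatrix u a b n z` along the tangent vector `(v, a', b')`. -/
def lenardMatrixDeriv (u a v a' b' : ℤ → 𝕜) (n : ℤ) (z : 𝕜) : Matrix (Fin 2) (Fin 2) 𝕜 :=
  !![b' n, -v n * (a (n + 1) + a n) - u n * (a' (n + 1) + a' n);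
     z * (a' n + a' (n - 1)), -z * (a' n + a' (n - 1)) + b' (n - 1)]

/-- The derivative of `H k u n z` along `v`. -/
def HDeriv (k : ℕ) (u : ℤ → 𝕜) (n : ℤ) (z : 𝕜) : (ℤ → 𝕜) →ₗ[𝕜] Matrix (Fin 2) (Fin 2) 𝕜 where
  toFun v := lenardMatrixDeriv u (fun n => h k n u) v (fun n => dh k n u v)
    (fun n => dh (k + 1) n u v) n z
  map_add' v w := by
    ext a b
    fin_cases a <;> fin_cases b <;> simp [lenardMatrixDeriv, dh_add] <;> ring
  map_smul' c v := by
    ext a b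
    fin_cases a <;> fin_cases b <;> simp [lenardMatrixDeriv, dh_smul] <;> ring

/-- The derivative of `U k u n z` along `v`. -/
def UDeriv (i : ℕ) (u : ℤ → 𝕜) (n : ℤ) (z : 𝕜) : (ℤ → 𝕜) →ₗ[𝕜] Matrix (Fin 2) (Fin 2) 𝕜 :=
  ∑ k ∈ Finset.range i, z ^ (i - 1 - k) • HDeriv k u n z

variable (u : ℤ → 𝕜) (n : ℤ) (z : 𝕜)

theorem sum_range_succ_pow_smul {M : Type*} [AddCommGroup M] [Module 𝕜 M] (f : ℕ → M) (i : ℕ) :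
    ∑ k ∈ Finset.range (i + 1), z ^ (i + 1 - 1 - k) • f k =
      z • (∑ k ∈ Finset.range i, z ^ (i - 1 - k) • f k) + f i := by
  rw [Finset.sum_range_succ, Finset.smul_sum]
  congr 1
  · refine Finset.sum_congr rfl fun k hk => ?_
    have := Finset.mem_range.1 hk
    rw [smul_smul, ← pow_succ']
    congr 2
    omega
  · simp

theorem U_zero : U 0 u n z = 0 := by simp [U]

theorem U_succ (i : ℕ) : U (i + 1) u n z = z • U i u n z + H i u n z :=
  sum_range_succ_pow_smul z _ i

theorem UDeriv_zero : UDeriv 0 u n z = 0 := by simp [UDeriv]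

theorem UDeriv_succ (i : ℕ) : UDeriv (i + 1) u n z = z • UDeriv i u n z + HDeriv i u n z :=
  sum_range_succ_pow_smul z _ i

theorem lenardMatrix_h (k : ℕ) :
    lenardMatrix u (fun n => h k n u) (fun n => h (k + 1) n u) n z = H k u n z := rfl

-- The Lenard relation kills the upper left entry. The surviving entry depends on b - z a, which
-- telescopes over the H^{(k)} and acquires the factor α^j - z for W^j.
variable {u} in
theorem LenardPair.lenardMatrix_mul_L {a b : ℤ → 𝕜} (hab : LenardPair u a b) (hz : z ≠ 0) :
    lenardMatrix u a b (n + 1) z * L u n z - L u n z * lenardMatrix u a b n z =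
      !![0, -u n / z * (b (n + 1) - b (n - 1) - z * (a (n + 1) - a (n - 1))); 0, 0] := by
  have e := hab n
  ext i j
  fin_cases i <;> fin_cases j <;>
    simp [lenardMatrix, L, show n + 1 + 1 = n + 2 by ring]
  · field_simp
    linear_combination e
  · field_simp; ring
  · field_simp; ring

variable [CharZero 𝕜]

theorem U_mul_L (k : ℕ) (hz : z ≠ 0) :
    U k u (n + 1) z * L u n z - L u n z * U k u n z =
      !![0, -u n / z * (h k (n + 1) u - h k (n - 1) u); 0, 0] := by
  induction k with
  | zero => simp [U_zero]; ext i j; fin_cases i <;> fin_cases j <;> rfl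
  | succ k ih =>
    have e := (lenardPair_h u k).lenardMatrix_mul_L n z hz
    rw [lenardMatrix_h, lenardMatrix_h] at e
    have : U (k + 1) u (n + 1) z * L u n z - L u n z * U (k + 1) u n z =
        z • (U k u (n + 1) z * L u n z - L u n z * U k u n z) +
          (H k u (n + 1) z * L u n z - L u n z * H k u n z) := by
      simp only [U_succ, add_mul, mul_add, smul_mul_assoc, mul_smul_comm, smul_sub]
      abel
    rw [this, ih, e]
    ext i j
    fin_cases i <;> fin_cases j <;> simp
    field_simp; ring

variable {u} in
/-- The commutator of `H k` with the matrix of a Lenard pair. -/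
theorem LenardPair.commutator_H {a b : ℤ → 𝕜} (hab : LenardPair u a b) (k : ℕ) :
    H k u n z * lenardMatrix u a b n z - lenardMatrix u a b n z * H k u n z =
      lenardMatrixDeriv u a (flow u fun n => h (k + 1) n u)
          (fun n => dh (k + 1) n u (flow u a)) (fun n => dh (k + 1) n u (flow u b)) n z
        - z • lenardMatrixDeriv u a (flow u fun n => h k n u)
          (fun n => dh k n u (flow u a)) (fun n => dh k n u (flow u b)) n z
        + z • HDeriv k u n z (flow u a) - HDeriv k u n z (flow u b) := by
  have m0 := hab.dh_sub k n
  have m1 := hab.dh_sub k (n + 1)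
  have m2 := hab.dh_sub k (n - 1)
  have l1 := lenardPair_h u k n
  have l2 := lenardPair_h u k (n - 1)
  have b1 := hab n
  have b2 := hab (n - 1)
  simp only [show n - 1 + 2 = n + 1 by ring, show n - 1 + 1 = n by ring,
    show n + 1 + 1 = n + 2 by ring, show n + 1 - 1 = n by ring] at m0 m1 m2 l1 l2 b1 b2
  ext i j
  fin_cases i <;> fin_cases j <;>
    simp [lenardMatrix, H, HDeriv, lenardMatrixDeriv, flow]
  · linear_combination z * m0
  · linear_combination -u n * (m0 + m1) + u n * (a (n + 1) + a n) * l1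
      - u n * (h k (n + 1) u + h k n u) * b1
  · linear_combination z * (m0 + m2) + z * (h k n u + h k (n - 1) u) * b2
      - z * (a n + a (n - 1)) * l2
  · linear_combination -z * m0

variable {u} in
/-- The commutator of `U i` with the matrix of a Lenard pair. -/
theorem LenardPair.commutator_U {a b : ℤ → 𝕜} (hab : LenardPair u a b) (i : ℕ) :
    U i u n z * lenardMatrix u a b n z - lenardMatrix u a b n z * U i u n z =
      lenardMatrixDeriv u a (flow u fun n => h i n u)
          (fun n => dh i n u (flow u a)) (fun n => dh i n u (flow u b)) n z
        + z • UDeriv i u n z (flow u a) - UDeriv i u n z (flow u b) := by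
  induction i with
  | zero =>
    ext i j
    fin_cases i <;> fin_cases j <;> simp [U_zero, UDeriv_zero, lenardMatrixDeriv, flow]
  | succ i ih =>
    -- The i-th flow term of `ih`, multiplied by z, cancels the corresponding term of `e`, leaving
    -- only the (i+1)-st.
    have e := hab.commutator_H n z i
    rw [U_succ, UDeriv_succ, add_mul, mul_add, smul_mul_assoc, mul_smul_comm,
      add_sub_add_comm, ← smul_sub, ih, e]
    simp only [LinearMap.add_apply, LinearMap.smul_apply, smul_add, smul_sub]
    abel

/-- The zero curvature relation for `U i` and `U k`. -/
theorem commutator_U_U (i k : ℕ) :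
    U i u n z * U k u n z - U k u n z * U i u n z =
      UDeriv k u n z (flow u fun n => h i n u) - UDeriv i u n z (flow u fun n => h k n u) := by
  induction k with
  | zero => rw [flow_h_zero]; simp [U_zero, UDeriv_zero]
  | succ k ih =>
    have e := (lenardPair_h u k).commutator_U n z i
    rw [lenardMatrix_h] at e
    -- Symmetry of the flows turns the first term into the derivative of H^{(k)} along the i-th
    -- flow.
    simp only [← dh_flow_h_comm u i] at e
    rw [U_succ, UDeriv_succ, add_mul, mul_add, smul_mul_assoc, mul_smul_comm,
      add_sub_add_comm, ← smul_sub, ih, e]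
    simp only [LinearMap.add_apply, LinearMap.smul_apply, smul_sub, HDeriv, LinearMap.coe_mk,
      AddHom.coe_mk]
    abel

end matrices

/-! ### Differentiation in the spectral parameter. -/

section spectral

variable [RCLike 𝕜] (u : ℤ → 𝕜) (n : ℤ) (z : 𝕜)

/-- Euler's identity: the entries of U^{(i)} are jointly homogeneous of degree i in u and z. The
derivative is built along U^{(i+1)} = z U^{(i)} + H^{(i)}. -/
theorem exists_hasDerivAt_U (i : ℕ) : ∃ D : Matrix (Fin 2) (Fin 2) 𝕜,
    (∀ a b, HasDerivAt (fun s => U i u n s a b) (D a b) z) ∧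
      z • D = (i : 𝕜) • U i u n z - UDeriv i u n z u := by
  induction i with
  | zero => exact ⟨0, fun a b => by simpa [U_zero] using hasDerivAt_const z (0 : 𝕜),
      by simp [UDeriv_zero]⟩
  | succ i ih =>
    obtain ⟨D, hD, e⟩ := ih
    set D' : Matrix (Fin 2) (Fin 2) 𝕜 :=
      !![0, 0; h i n u + h i (n - 1) u, -(h i n u + h i (n - 1) u)] with hD'
    have hH : ∀ a b, HasDerivAt (fun s => H i u n s a b) (D' a b) z := by
      intro a b
      have h1 := (hasDerivAt_id z).mul_const (h i n u + h i (n - 1) u)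
      have h2 := (h1.neg).add_const (h (i + 1) (n - 1) u)
      fin_cases a <;> fin_cases b <;> simp [H, hD', hasDerivAt_const]
      · simpa using h1
      · simpa using h2
    refine ⟨U i u n z + z • D + D', fun a b => ?_, ?_⟩
    · have := ((hasDerivAt_id z).mul (hD a b)).add (hH a b)
      simpa [U_succ, Pi.add_def, Pi.mul_def] using this
    · have e' : z • D' = ((i + 1 : ℕ) : 𝕜) • H i u n z - HDeriv i u n z u := by
        ext a b
        fin_cases a <;> fin_cases b <;>
          simp [hD', H, HDeriv, lenardMatrixDeriv, dh_self] <;> ring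
      rw [smul_add, smul_add, e, e', U_succ, UDeriv_succ]
      simp only [LinearMap.add_apply, LinearMap.smul_apply]
      push_cast
      module

theorem smul_specDeriv_U (i : ℕ) :
    z • specDeriv (fun s => U i u n s) z = (i : 𝕜) • U i u n z - UDeriv i u n z u := by
  obtain ⟨D, hD, e⟩ := exists_hasDerivAt_U u n z i
  rw [← e]
  congr 1
  ext a b
  exact (hD a b).deriv

theorem smul_specDeriv_L (hz : z ≠ 0) :
    (2 * z) • specDeriv (fun s => L u n s) z = !![0, 2 * u n / z; 0, 0] := by
  ext a b
  fin_cases a <;> fin_cases b <;> simp [specDeriv, L]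
  field_simp

end spectral

/-! ### Consequences of the algebraic system (1) for the Lax equations. -/

section reduction

variable [RCLike 𝕜] {m r : ℕ} (p : Params 𝕜 m) {u : ℤ → 𝕜} {y : Fin m → ℤ → 𝕜}

/-- The sequence paired with `y^j` by the Lenard operator. -/
def lenardPartner (j : Fin m) (y : ℤ → 𝕜) (n : ℤ) : 𝕜 :=
  p.α j * y n + (-1) ^ n * (p.β j / 2)

theorem neg_one_zpow_add_one (n : ℤ) : (-1 : 𝕜) ^ (n + 1) = -(-1) ^ n := by
  rw [zpow_add_one₀ (by simp)]; ring

theorem neg_one_zpow_sub_one (n : ℤ) : (-1 : 𝕜) ^ (n - 1) = -(-1) ^ n := by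
  rw [zpow_sub_one₀ (by simp)]; norm_num

theorem flow_lenardPartner (u : ℤ → 𝕜) (j : Fin m) (y : ℤ → 𝕜) :
    flow u (lenardPartner p j y) = p.α j • flow u y := by
  funext n
  simp only [flow, lenardPartner, neg_one_zpow_add_one, neg_one_zpow_sub_one, Pi.smul_apply,
    smul_eq_mul]
  ring

variable {p}

/-- In the difference of the equations at n and n + 1, γ drops out and the alternating sign of β
makes everything divisible by y_{n+1} + y_n. -/
theorem YEquations.lenardPair (hy : YEquations p u y) (hne : ∀ j n, y j n + y j (n - 1) ≠ 0)
    (j : Fin m) : LenardPair u (y j) (lenardPartner p j (y j)) := by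
  intro n
  have e1 := hy j n
  have e2 := hy j (n + 1)
  have h0 := hne j (n + 1)
  simp only [quad, lenardPartner, neg_one_zpow_add_one, show n + 1 + 1 = n + 2 by ring,
    show n + 1 - 1 = n by ring] at *
  apply mul_left_cancel₀ h0
  linear_combination e1 - e2

theorem Wj_eq_lenardMatrix (hy : YEquations p u y) (hne : ∀ j n, y j n + y j (n - 1) ≠ 0)
    (j : Fin m) (n : ℤ) (z : 𝕜) :
    Wj p j y n z = lenardMatrix u (y j) (lenardPartner p j (y j)) n z := by
  have e : quad p j n (y j n) / (y j n + y j (n - 1)) = u n * (y j (n + 1) + y j n) := by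
    rw [div_eq_iff (hne j n), hy j n]
  rw [Wj, lenardMatrix, e]
  simp only [lenardPartner, neg_one_zpow_sub_one]
  congr 1
  ext a b
  fin_cases a <;> fin_cases b <;> simp
  ring

variable (p u y) in
/-- The derivative of `Wj p j y n z` along the `i`-th flow. -/
def WjDeriv (i : ℕ) (j : Fin m) (n : ℤ) (z : 𝕜) : Matrix (Fin 2) (Fin 2) 𝕜 :=
  lenardMatrixDeriv u (y j) (flow u fun n => h i n u) (fun n => dh i n u (flow u (y j)))
    (fun n => p.α j * dh i n u (flow u (y j))) n z

variable (p u y) in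
/-- The derivative of `W p t u y n z` along the `i`-th flow, `t_i` included. -/
def WDeriv (t : Fin r → 𝕜) (i : ℕ) (n : ℤ) (z : 𝕜) : Matrix (Fin 2) (Fin 2) 𝕜 :=
  (2 * (i : 𝕜)) • U i u n z
    + (2 : 𝕜) • ∑ k : Fin r, (((k.val + 1 : ℕ) : 𝕜) * t k) •
        UDeriv (k.val + 1) u n z (flow u fun n => h i n u)
    + ∑ j : Fin m, (1 / (z - p.α j)) • WjDeriv p u y i j n z

theorem commutator_U_Wj (hy : YEquations p u y) (hne : ∀ j n, y j n + y j (n - 1) ≠ 0)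
    (i : ℕ) (j : Fin m) (n : ℤ) (z : 𝕜) :
    U i u n z * Wj p j y n z - Wj p j y n z * U i u n z =
      WjDeriv p u y i j n z + (z - p.α j) • UDeriv i u n z (flow u (y j)) := by
  rw [Wj_eq_lenardMatrix hy hne, (hy.lenardPair hne j).commutator_U, flow_lenardPartner]
  simp only [dh_smul, map_smul, WjDeriv]
  module

/-- The symmetry that defines the reduction. -/
theorem Constraint.flow_eq {t : Fin r → 𝕜} (hc : Constraint p t u y) :
    (2 : 𝕜) • u + (2 : 𝕜) • (∑ k : Fin r, (((k.val + 1 : ℕ) : 𝕜) * t k) •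
      flow u fun n => h (k.val + 1) n u) = ∑ j, flow u (y j) := by
  funext n
  -- In the difference of the constraints at n + 1 and n - 1, n contributes 2, while δ and the ε
  -- term drop out because the parities agree.
  have e1 := hc (n + 1)
  have e2 := hc (n - 1)
  rw [neg_one_zpow_add_one] at e1
  rw [neg_one_zpow_sub_one] at e2
  simp only [Pi.add_apply, Pi.smul_apply, Finset.sum_apply, flow, smul_eq_mul]
  rw [← Finset.mul_sum, Finset.sum_sub_distrib, ← e1, ← e2]
  have : ∑ k : Fin r, ((k.val + 1 : ℕ) : 𝕜) * t k *
      (u n * (h (k.val + 1) (n + 1) u - h (k.val + 1) (n - 1) u)) =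
      u n * (∑ k : Fin r, ((k.val + 1 : ℕ) : 𝕜) * t k * h (k.val + 1) (n + 1) u
        - ∑ k : Fin r, ((k.val + 1 : ℕ) : 𝕜) * t k * h (k.val + 1) (n - 1) u) := by
    rw [← Finset.sum_sub_distrib, Finset.mul_sum]
    exact Finset.sum_congr rfl fun k _ => by ring
  rw [this]
  push_cast
  ring

/-- The constraint is preserved by the flows. -/
theorem Constraint.sum_dh {t : Fin r → 𝕜} (hc : Constraint p t u y) (i : ℕ) (n : ℤ) :
    2 * (i * h i n u) + 2 * ∑ k : Fin r, ((k.val + 1 : ℕ) : 𝕜) * t k *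
        dh (k.val + 1) n u (flow u fun n => h i n u) =
      ∑ j, dh i n u (flow u (y j)) := by
  have := congrArg (dh i n u) hc.flow_eq
  simpa only [dh_add, dh_smul, dh_sum, dh_self, dh_flow_h_comm u _ i] using this

/-- The right hand side of the second Lax equation. -/
theorem Constraint.lax_rhs {t : Fin r → 𝕜} (hc : Constraint p t u y) (hy : YEquations p u y)
    (hne : ∀ j n, y j n + y j (n - 1) ≠ 0) (i : ℕ) (n : ℤ) (z : 𝕜) (hz : ∀ j, z ≠ p.α j) :
    (2 * z) • specDeriv (fun s => U i u n s) z
        + (U i u n z * W p t u y n z - W p t u y n z * U i u n z) = WDeriv p u y t i n z := by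
  have e1 : (2 * z) • specDeriv (fun s => U i u n s) z =
      (2 : 𝕜) • ((i : 𝕜) • U i u n z - UDeriv i u n z u) := by
    rw [← smul_specDeriv_U, smul_smul]
  have e2 : U i u n z * W p t u y n z - W p t u y n z * U i u n z =
      (2 : 𝕜) • ∑ k : Fin r, (((k.val + 1 : ℕ) : 𝕜) * t k) •
        (U i u n z * U (k.val + 1) u n z - U (k.val + 1) u n z * U i u n z)
      + ∑ j, (1 / (z - p.α j)) • (U i u n z * Wj p j y n z - Wj p j y n z * U i u n z) := by
    simp only [W, mul_add, add_mul, Finset.mul_sum, Finset.sum_mul, mul_smul_comm,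
      smul_mul_assoc, smul_sub, Finset.sum_sub_distrib]
    abel
  have e3 := congrArg (UDeriv i u n z) hc.flow_eq
  simp only [map_add, map_smul, map_sum] at e3
  -- The factor z - α^j cancels the pole; the resulting sum over j is evaluated by `e3`.
  have e4 : ∑ j, (1 / (z - p.α j)) • (U i u n z * Wj p j y n z - Wj p j y n z * U i u n z) =
      ∑ j, (1 / (z - p.α j)) • WjDeriv p u y i j n z + ∑ j, UDeriv i u n z (flow u (y j)) := by
    rw [← Finset.sum_add_distrib]
    refine Finset.sum_congr rfl fun j _ => ?_
    rw [commutator_U_Wj hy hne, smul_add, smul_smul, one_div_mul_cancel (sub_ne_zero.2 (hz j)),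
      one_smul]
  rw [e4] at e2
  simp only [commutator_U_U, smul_sub, Finset.sum_sub_distrib] at e2
  rw [e1, e2, ← e3, WDeriv]
  module

/-- The first Lax equation. -/
theorem Constraint.lax_fst {t : Fin r → 𝕜} (hc : Constraint p t u y) (hy : YEquations p u y)
    (hne : ∀ j n, y j n + y j (n - 1) ≠ 0) (n : ℤ) (z : 𝕜) (hz0 : z ≠ 0)
    (hz : ∀ j, z ≠ p.α j) :
    (2 * z) • specDeriv (fun s => L u n s) z =
      W p t u y (n + 1) z * L u n z - L u n z * W p t u y n z := by
  have e2 : W p t u y (n + 1) z * L u n z - L u n z * W p t u y n z =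
      (2 : 𝕜) • ∑ k : Fin r, (((k.val + 1 : ℕ) : 𝕜) * t k) •
        (U (k.val + 1) u (n + 1) z * L u n z - L u n z * U (k.val + 1) u n z)
      + ∑ j, (1 / (z - p.α j)) • (Wj p j y (n + 1) z * L u n z - L u n z * Wj p j y n z) := by
    simp only [W, mul_add, add_mul, Finset.mul_sum, Finset.sum_mul, mul_smul_comm,
      smul_mul_assoc, smul_sub, Finset.sum_sub_distrib]
    abel
  have e3 : ∀ j, (1 / (z - p.α j)) • (Wj p j y (n + 1) z * L u n z - L u n z * Wj p j y n z) =
      (u n / z) • !![0, y j (n + 1) - y j (n - 1); 0, 0] := by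
    intro j
    have := sub_ne_zero.2 (hz j)
    rw [Wj_eq_lenardMatrix hy hne, Wj_eq_lenardMatrix hy hne,
      (hy.lenardPair hne j).lenardMatrix_mul_L n z hz0]
    simp only [lenardPartner, neg_one_zpow_add_one, neg_one_zpow_sub_one]
    ext a b
    fin_cases a <;> fin_cases b <;> simp
    field_simp
    ring
  have e1 := hc (n + 1)
  have e0 := hc (n - 1)
  rw [neg_one_zpow_add_one] at e1
  rw [neg_one_zpow_sub_one] at e0
  push_cast at e1 e0
  rw [e2, smul_specDeriv_L u n z hz0]
  simp only [e3, U_mul_L u n z _ hz0]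
  ext a b
  fin_cases a <;> fin_cases b <;> simp [Matrix.sum_apply]
  rw [← Finset.mul_sum, Finset.sum_sub_distrib, ← e1, ← e0]
  have : ∑ k : Fin r, ((k.val : 𝕜) + 1) * t k *
      (-u n / z * (h (k.val + 1) (n + 1) u - h (k.val + 1) (n - 1) u)) =
      -u n / z * (∑ k : Fin r, ((k.val : 𝕜) + 1) * t k * h (k.val + 1) (n + 1) u
        - ∑ k : Fin r, ((k.val : 𝕜) + 1) * t k * h (k.val + 1) (n - 1) u) := by
    rw [← Finset.sum_sub_distrib, Finset.mul_sum]
    exact Finset.sum_congr rfl fun k _ => by ring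
  rw [this]
  ring

end reduction

/-! ### Differentiation along the times, and part (a). -/

section analysis

variable [RCLike 𝕜]

/-- Induction on the polynomial needs only coordinatewise derivatives, so no differentiability of
the infinite sequence as a whole enters. -/
theorem hasDerivAt_eval {f : 𝕜 → ℤ → 𝕜} {v : ℤ → 𝕜} {s₀ : 𝕜}
    (hf : ∀ k, HasDerivAt (fun s => f s k) (v k) s₀) (P : MvPolynomial ℤ 𝕜) :
    HasDerivAt (fun s => MvPolynomial.eval (f s) P) (dirDeriv (f s₀) v P) s₀ := by
  induction P using MvPolynomial.induction_on with
  | C c => simpa [dirDeriv_C] using hasDerivAt_const s₀ c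
  | add P Q hP hQ => simpa [dirDeriv_add, Pi.add_def] using hP.add hQ
  | mul_X P k hP =>
    have := hP.mul (hf k)
    rw [dirDeriv_mul, dirDeriv_X, MvPolynomial.eval_X]
    simp only [map_mul, MvPolynomial.eval_X]
    exact this.congr_deriv (by ring)

theorem hasDerivAt_h {f : 𝕜 → ℤ → 𝕜} {v : ℤ → 𝕜} {s₀ : 𝕜}
    (hf : ∀ k, HasDerivAt (fun s => f s k) (v k) s₀) (i : ℕ) (n : ℤ) :
    HasDerivAt (fun s => h i n (f s)) (dh i n (f s₀) v) s₀ :=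
  hasDerivAt_eval hf _

theorem hasDerivAt_lenardMatrix {f a b : 𝕜 → ℤ → 𝕜} {v a' b' : ℤ → 𝕜} {s₀ : 𝕜}
    (hf : ∀ k, HasDerivAt (fun s => f s k) (v k) s₀)
    (ha : ∀ k, HasDerivAt (fun s => a s k) (a' k) s₀)
    (hb : ∀ k, HasDerivAt (fun s => b s k) (b' k) s₀) (n : ℤ) (z : 𝕜) (c d : Fin 2) :
    HasDerivAt (fun s => lenardMatrix (f s) (a s) (b s) n z c d)
      (lenardMatrixDeriv (f s₀) (a s₀) v a' b' n z c d) s₀ := by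
  have h3 := ((ha n).add (ha (n - 1))).const_mul z
  fin_cases c <;> fin_cases d <;> simp [lenardMatrix, lenardMatrixDeriv]
  · exact hb n
  · have := ((hf n).mul ((ha (n + 1)).add (ha n))).neg
    exact this.congr_deriv (by simp only [Pi.add_apply]; ring)
  · exact h3
  · exact h3.neg.add (hb (n - 1))

theorem hasDerivAt_U {f : 𝕜 → ℤ → 𝕜} {v : ℤ → 𝕜} {s₀ : 𝕜}
    (hf : ∀ k, HasDerivAt (fun s => f s k) (v k) s₀) (i : ℕ) (n : ℤ) (z : 𝕜) (c d : Fin 2) :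
    HasDerivAt (fun s => U i (f s) n z c d) (UDeriv i (f s₀) n z v c d) s₀ := by
  simp only [U, UDeriv, Matrix.sum_apply, LinearMap.sum_apply, Matrix.smul_apply,
    LinearMap.smul_apply, smul_eq_mul]
  exact HasDerivAt.fun_sum fun k _ => (hasDerivAt_lenardMatrix hf
    (fun n => hasDerivAt_h hf k n) (fun n => hasDerivAt_h hf (k + 1) n) n z c d).const_mul _

theorem HasPartialDerivAt.congr_of_isOpen {r : ℕ} {Ω : Set (Fin r → 𝕜)} (hΩ : IsOpen Ω)
    {f g : (Fin r → 𝕜) → 𝕜} {f' : 𝕜} {i : Fin r} {τ : Fin r → 𝕜} (hτ : τ ∈ Ω)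
    (hf : HasPartialDerivAt f f' i τ) (hfg : ∀ σ ∈ Ω, f σ = g σ) : HasPartialDerivAt g f' i τ := by
  refine HasDerivAt.congr_of_eventuallyEq hf ?_
  have hc : Filter.Tendsto (fun s => Function.update τ i s) (nhds (τ i)) (nhds τ) := by
    have : Continuous fun s => Function.update τ i s := by fun_prop
    simpa using this.tendsto (τ i)
  filter_upwards [hc (hΩ.mem_nhds hτ)] with s hs
  exact (hfg _ hs).symm

theorem hasPartialDerivAt_coord {r : ℕ} (i k : Fin r) (τ : Fin r → 𝕜) :
    HasPartialDerivAt (fun σ => σ k) (if k = i then 1 else 0) i τ := by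
  unfold HasPartialDerivAt
  split_ifs with hk
  · subst hk
    simpa using hasDerivAt_id' (τ k)
  · simpa [Function.update_of_ne hk] using hasDerivAt_const (τ i) (τ k)

/-- The isomonodromic Lax pair. -/
theorem laxEquations_W {r m : ℕ} {p : Params 𝕜 m} {Ω : Set (Fin r → 𝕜)}
    {u : (Fin r → 𝕜) → ℤ → 𝕜} {y : (Fin r → 𝕜) → Fin m → ℤ → 𝕜} (hΩ : IsOpen Ω)
    (hne : ∀ τ ∈ Ω, ∀ (j : Fin m) (n : ℤ), y τ j n + y τ j (n - 1) ≠ 0)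
    (heq : ∀ τ ∈ Ω, YEquations p (u τ) (y τ) ∧ Constraint p τ (u τ) (y τ))
    (hfl : Flows Ω u y) :
    LaxEquations p Ω u (fun τ n z => W p τ (u τ) (y τ) n z) := by
  intro τ hτ n z hz0 hz
  obtain ⟨hy, hc⟩ := heq τ hτ
  refine ⟨hc.lax_fst hy (hne τ hτ) n z hz0 hz, fun i c d => ?_⟩
  rw [hc.lax_rhs hy (hne τ hτ) _ n z hz]
  have hu : ∀ k, HasDerivAt (fun s => u (Function.update τ i s) k)
      (flow (u τ) (fun n => h (i.val + 1) n (u τ)) k) (τ i) := fun k => (hfl τ hτ i k).1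
  have hyj : ∀ j k, HasDerivAt (fun s => y (Function.update τ i s) j k)
      (dh (i.val + 1) k (u τ) (flow (u τ) (y τ j))) (τ i) := fun j k => by
    rw [← hXi_eq_dh]; exact (hfl τ hτ i k).2 j
  -- On Ω the quotient in W^j equals a polynomial expression, and this form is differentiated;
  -- openness of Ω transfers the result to W.
  have key : HasPartialDerivAt (fun σ => (2 * ∑ k : Fin r, ((k.val + 1 : ℕ) : 𝕜) * σ k *
        U (k.val + 1) (u σ) n z c d) + ∑ j : Fin m, (1 / (z - p.α j)) *
          lenardMatrix (u σ) (y σ j) (lenardPartner p j (y σ j)) n z c d)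
      (WDeriv p (u τ) (y τ) τ (i.val + 1) n z c d) i τ := by
    have h1 := fun k : Fin r => (((hasPartialDerivAt_coord i k τ).const_mul
      ((k.val + 1 : ℕ) : 𝕜)).mul (hasDerivAt_U hu (k.val + 1) n z c d))
    have h2 := fun j : Fin m => (hasDerivAt_lenardMatrix hu (hyj j)
      (fun k => ((hyj j k).const_mul (p.α j)).add_const ((-1) ^ k * (p.β j / 2))) n z c d).const_mul
        (1 / (z - p.α j))
    have h3 := ((HasDerivAt.fun_sum fun k (_ : k ∈ Finset.univ) => h1 k).const_mul 2).add
      (HasDerivAt.fun_sum fun j (_ : j ∈ Finset.univ) => h2 j)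
    refine HasDerivAt.congr_deriv h3 ?_
    simp only [Function.update_eq_self, WDeriv, Matrix.add_apply, Matrix.smul_apply,
      Matrix.sum_apply, smul_eq_mul, WjDeriv]
    congr 1
    rw [Finset.sum_add_distrib, mul_add]
    congr 1
    simp
    ring
  refine key.congr_of_isOpen hΩ hτ fun σ hσ => ?_
  simp only [W, Matrix.add_apply, Matrix.smul_apply, Matrix.sum_apply, smul_eq_mul,
    Wj_eq_lenardMatrix (heq σ hσ).1 (hne σ hσ)]

end analysis

/-! ### Explicit formulas for r = 2. -/

section twoTimes

theorem hPoly_one [Field 𝕜] [CharZero 𝕜] (n : ℤ) : hPoly 𝕜 1 n = MvPolynomial.X n := by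
  have h2 : (MvPolynomial.C (1 / 2) : MvPolynomial ℤ 𝕜) + MvPolynomial.C (1 / 2) = 1 := by
    rw [← MvPolynomial.C_add, add_halves, MvPolynomial.C_1]
  rw [hPoly]
  simp only [Nat.reduceAdd, Fin.sum_univ_one, Fin.sum_univ_zero, Fin.val_zero, Nat.sub_self]
  simp only [hPoly, h2]
  ring

theorem hPoly_two [Field 𝕜] [CharZero 𝕜] (n : ℤ) : hPoly 𝕜 2 n =
    MvPolynomial.X n * (MvPolynomial.X (n + 1) + MvPolynomial.X n + MvPolynomial.X (n - 1)) := by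
  have h2 : (MvPolynomial.C (1 / 2) : MvPolynomial ℤ 𝕜) + MvPolynomial.C (1 / 2) = 1 := by
    rw [← MvPolynomial.C_add, add_halves, MvPolynomial.C_1]
  have h0 : ∀ n, hPoly 𝕜 0 n = MvPolynomial.C (1 / 2) := fun n => by rw [hPoly]
  rw [hPoly]
  simp [Fin.sum_univ_two, -one_div, h0, h2, hPoly_one]
  ring

variable [Field 𝕜] [CharZero 𝕜] (u v y : ℤ → 𝕜) (n : ℤ)

theorem h_one : h 1 n u = u n := by simp [h, hPoly_one]

theorem h_two : h 2 n u = u n * (u (n + 1) + u n + u (n - 1)) := by simp [h, hPoly_two]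

theorem dh_one : dh 1 n u v = v n := by rw [dh, hPoly_one, dirDeriv_X]

theorem dh_two : dh 2 n u v =
    u n * (v (n + 1) + v n + v (n - 1)) + v n * (u (n + 1) + u n + u (n - 1)) := by
  rw [dh, hPoly_two]
  simp only [dirDeriv_mul, dirDeriv_add, dirDeriv_X, map_add, MvPolynomial.eval_X]
  ring

theorem dh_two_flow : dh 2 n u (flow u y) =
    u n * (u (n + 1) * (y (n + 2) - y n)
      + (u (n + 1) + 2 * u n + u (n - 1)) * (y (n + 1) - y (n - 1))
      + u (n - 1) * (y n - y (n - 2))) := by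
  rw [dh_two]
  simp only [flow, show n + 1 + 1 = n + 2 by ring, show n + 1 - 1 = n by ring,
    show n - 1 + 1 = n by ring, show n - 1 - 1 = n - 2 by ring]
  ring

theorem flow_h_two : flow u (fun n => h 2 n u) n =
    u n * (u (n + 1) * (u (n + 2) + u (n + 1) + u n)
      - u (n - 1) * (u n + u (n - 1) + u (n - 2))) := by
  simp only [flow, h_two, show n + 1 + 1 = n + 2 by ring, show n + 1 - 1 = n by ring,
    show n - 1 + 1 = n by ring, show n - 1 - 1 = n - 2 by ring]

theorem constraint_iff_constraintXT {m : ℕ} {p : Params 𝕜 m} {τ : Fin 2 → 𝕜} {u : ℤ → 𝕜}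
    {y : Fin m → ℤ → 𝕜} : Constraint p τ u y ↔ ConstraintXT p (τ 0) (τ 1) u y := by
  refine forall_congr' fun n => ?_
  rw [Fin.sum_univ_two]
  simp only [Fin.val_zero, Fin.val_one, zero_add, Nat.reduceAdd, h_one, h_two]
  push_cast
  rw [show 2 * (1 * τ 0 * u n + 2 * τ 1 * (u n * (u (n + 1) + u n + u (n - 1)))) =
    4 * τ 1 * u n * (u (n + 1) + u n + u (n - 1)) + 2 * τ 0 * u n by ring]

end twoTimes

variable [RCLike 𝕜] {m : ℕ} {p : Params 𝕜 m}

theorem flows_iff_flowsXT {Ω : Set (Fin 2 → 𝕜)} {u : (Fin 2 → 𝕜) → ℤ → 𝕜}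
    {y : (Fin 2 → 𝕜) → Fin m → ℤ → 𝕜} : Flows Ω u y ↔ FlowsXT Ω u y := by
  have e1 : ∀ (u : ℤ → 𝕜) n, u n * (h 2 (n + 1) u - h 2 (n - 1) u) = _ := flow_h_two
  have e2 : ∀ (u y : ℤ → 𝕜) n, dh 1 n u (flow u y) = u n * (y (n + 1) - y (n - 1)) :=
    fun u y n => dh_one u _ n
  refine forall₂_congr fun τ _ => ?_
  simp only [Fin.forall_fin_two, Fin.val_zero, Fin.val_one, zero_add, Nat.reduceAdd, h_one, e1,
    hXi_eq_dh, e2, dh_two_flow]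
  constructor
  · rintro ⟨hx, ht⟩ n
    exact ⟨(hx n).1, (ht n).1, fun j => ⟨(hx n).2 j, (ht n).2 j⟩⟩
  · intro hf
    exact ⟨fun n => ⟨(hf n).1, fun j => ((hf n).2.2 j).1⟩,
      fun n => ⟨(hf n).2.1, fun j => ((hf n).2.2 j).2⟩⟩

/-! ### Part (b) and invariance under constant scalar shifts. -/

/-- The elimination of `u_{n-2}` and `u_{n+1}` changes `W` by a constant scalar matrix. -/
theorem W_eq_WXT_add {τ : Fin 2 → 𝕜} {u : ℤ → 𝕜} {y : Fin m → ℤ → 𝕜}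
    (hc : ConstraintXT p (τ 0) (τ 1) u y) (n : ℤ) (z : 𝕜) (hz : ∀ j, z ≠ p.α j) :
    W p τ u y n z =
      WXT p (τ 0) (τ 1) u y n z + (1 + p.δ) • (1 : Matrix (Fin 2) (Fin 2) 𝕜) := by
  have hs : ∀ j, (z - p.α j)⁻¹ * (z - p.α j) = 1 := fun j =>
    inv_mul_cancel₀ (sub_ne_zero.2 (hz j))
  -- The constraint at n eliminates u_{n+1} from the first row, that at n - 1 eliminates u_{n-2}
  -- from the lower right entry. The sums of y^j arise from z/(z - α) = 1 + α/(z - α).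
  have e0 := hc n
  have e1 := hc (n - 1)
  rw [neg_one_zpow_sub_one, show n - 1 + 1 = n by ring, show n - 1 - 1 = n - 2 by ring] at e1
  push_cast at e1
  simp only [W, WXT, Fin.sum_univ_two, Fin.val_zero, Fin.val_one, zero_add, Nat.reduceAdd,
    U_succ, U_zero, H, Wj]
  ext a b
  fin_cases a <;> fin_cases b <;>
    simp [Matrix.sum_apply, h_one, h_two, show n - 1 + 1 = n by ring,
      show n - 1 - 1 = n - 2 by ring]
  · have : ∑ j, (z - p.α j)⁻¹ * (z * y j n + (-1) ^ n * (p.β j / 2)) =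
        ∑ j, (z - p.α j)⁻¹ * (p.α j * y j n + (-1) ^ n * (p.β j / 2)) + ∑ j, y j n := by
      rw [← Finset.sum_add_distrib]
      exact Finset.sum_congr rfl fun j _ => by linear_combination y j n * hs j
    rw [this]
    linear_combination e0
  · have : ∑ j, (z - p.α j)⁻¹ *
          ((p.α j - z) * y j n - quad p j n (y j n) / (y j n + y j (n - 1))) =
        ∑ j, (z - p.α j)⁻¹ * (-(quad p j n (y j n) / (y j n + y j (n - 1)))) - ∑ j, y j n := by
      rw [← Finset.sum_sub_distrib]
      exact Finset.sum_congr rfl fun j _ => by linear_combination -y j n * hs j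
    simp at this
    rw [this]
    linear_combination -e0
  · ring
  · have : ∑ j, (z - p.α j)⁻¹ * (-(z * y j n) - (-1) ^ n * (p.β j / 2)) =
        ∑ j, (z - p.α j)⁻¹ * (-(z * (y j n + y j (n - 1))) + p.α j * y j (n - 1)
          - (-1) ^ n * (p.β j / 2)) + ∑ j, y j (n - 1) := by
      rw [← Finset.sum_add_distrib]
      exact Finset.sum_congr rfl fun j _ => by linear_combination y j (n - 1) * hs j
    rw [this]
    linear_combination e1

theorem commutator_add_smul_one (A B : Matrix (Fin 2) (Fin 2) 𝕜) (c : 𝕜) :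
    A * (B + c • 1) - (B + c • 1) * A = A * B - B * A := by
  simp only [mul_add, add_mul, mul_smul_comm, smul_mul_assoc, mul_one, one_mul]
  abel

/-- The Lax equations do not change when a constant scalar matrix is added. -/
theorem LaxEquations.of_add_smul_one {r : ℕ} {Ω : Set (Fin r → 𝕜)} (hΩ : IsOpen Ω)
    {u : (Fin r → 𝕜) → ℤ → 𝕜} {V V' : (Fin r → 𝕜) → ℤ → 𝕜 → Matrix (Fin 2) (Fin 2) 𝕜} {c : 𝕜}
    (hV : ∀ τ ∈ Ω, ∀ n z, (∀ j, z ≠ p.α j) → V' τ n z = V τ n z + c • 1)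
    (hl : LaxEquations p Ω u V') : LaxEquations p Ω u V := by
  intro τ hτ n z hz0 hz
  obtain ⟨h1, h2⟩ := hl τ hτ n z hz0 hz
  constructor
  · rw [h1, hV τ hτ _ z hz, hV τ hτ _ z hz]
    simp only [mul_add, add_mul, mul_smul_comm, smul_mul_assoc, mul_one, one_mul]
    abel
  · intro i a b
    have h3 := h2 i a b
    rw [hV τ hτ n z hz, commutator_add_smul_one] at h3
    have h4 : HasPartialDerivAt (fun σ => V' σ n z a b - (c • (1 : Matrix (Fin 2) (Fin 2) 𝕜)) a b)
        _ i τ := HasDerivAt.sub_const _ h3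
    exact h4.congr_of_isOpen hΩ hτ fun σ hσ => by simp [hV σ hσ n z hz]

/-! ### Partial fractions and recovery of the algebraic system. -/

theorem eventually_ne_nhdsNE (a b : 𝕜) : ∀ᶠ z in nhdsWithin a {a}ᶜ, z ≠ b := by
  rcases eq_or_ne a b with rfl | hab
  · exact self_mem_nhdsWithin
  · exact eventually_nhdsWithin_of_eventually_nhds (eventually_ne_nhds hab)

/-- Uniqueness of partial fraction decompositions. -/
theorem eq_zero_of_partialFractions {α : Fin m → 𝕜} (hα : Function.Injective α) {c₀ : 𝕜}
    {c : Fin m → 𝕜}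
    (hc : ∀ z, z ≠ 0 → (∀ j, z ≠ α j) → c₀ + ∑ j, 1 / (z - α j) * c j = 0) :
    c₀ = 0 ∧ ∀ j, c j = 0 := by
  have hev : ∀ a, ∀ᶠ z in nhdsWithin a {a}ᶜ, z ≠ 0 ∧ ∀ j, z ≠ α j := fun a =>
    (eventually_ne_nhdsNE a 0).and (Filter.eventually_all.2 fun j => eventually_ne_nhdsNE a (α j))
  have hj : ∀ k, c k = 0 := by
    intro k
    -- The sum multiplied by z - α_k, with the pole removed: g is continuous at α_k, vanishes nearby
    -- off α_k, and has the value c_k there.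
    set g : 𝕜 → 𝕜 := fun z => (z - α k) * c₀ + c k +
      ∑ j ∈ Finset.univ.erase k, (z - α k) / (z - α j) * c j with hg
    have hcont : ContinuousAt g (α k) := by
      refine ContinuousAt.add (by fun_prop) ?_
      refine tendsto_finsetSum _ fun j hj => ?_
      have hne : α k - α j ≠ 0 := sub_ne_zero.2 fun e => Finset.ne_of_mem_erase hj (hα e).symm
      have : ContinuousAt (fun z => (z - α k) / (z - α j) * c j) (α k) :=
        ContinuousAt.mul (ContinuousAt.div (by fun_prop) (by fun_prop) hne) (by fun_prop)
      exact this
    have h0 : ∀ᶠ z in nhdsWithin (α k) {α k}ᶜ, g z = 0 := by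
      filter_upwards [hev (α k)] with z hz
      have e := hc z hz.1 hz.2
      rw [← Finset.add_sum_erase _ _ (Finset.mem_univ k)] at e
      have hk : z - α k ≠ 0 := sub_ne_zero.2 (hz.2 k)
      have e' := congrArg (fun w => (z - α k) * w) e
      simp only [mul_add, mul_zero, Finset.mul_sum] at e'
      rw [← mul_assoc, mul_one_div_cancel hk, one_mul] at e'
      rw [← e', ← add_assoc]
      refine congrArg ((z - α k) * c₀ + c k + ·) (Finset.sum_congr rfl fun j _ => by ring)
    have h1 : Filter.Tendsto g (nhdsWithin (α k) {α k}ᶜ) (nhds 0) :=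
      tendsto_const_nhds.congr' (h0.mono fun z hz => hz.symm)
    have h2 := tendsto_nhds_unique h1 (hcont.tendsto.mono_left nhdsWithin_le_nhds)
    simpa [hg] using h2.symm
  obtain ⟨z, hz⟩ := (hev 0).exists
  exact ⟨by simpa [hj] using hc z hz.1 hz.2, hj⟩

/-- The first Lax equation contains the reduction. -/
theorem equations_of_lax_fst (hα : Function.Injective p.α) {x t : 𝕜} {u : ℤ → 𝕜}
    {y : Fin m → ℤ → 𝕜} (hne : ∀ j n, y j n + y j (n - 1) ≠ 0)
    (hl : ∀ (n : ℤ) (z : 𝕜), z ≠ 0 → (∀ j, z ≠ p.α j) →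
      (2 * z) • specDeriv (fun s => L u n s) z =
        WXT p x t u y (n + 1) z * L u n z - L u n z * WXT p x t u y n z) :
    YEquations p u y ∧ ConstraintXT p x t u y := by
  have key : ∀ n, (4 * t * u n * (u (n + 1) + u n + u (n - 1)) + 2 * x * u n
        + (n : 𝕜) - p.δ + (-1) ^ n * p.ε - ∑ j, y j n) = 0 ∧
      ∀ j, u n * (y j (n + 1) + y j n) - quad p j n (y j n) / (y j n + y j (n - 1)) = 0 := by
    intro n
    refine eq_zero_of_partialFractions hα fun z hz0 hz => ?_
    -- The left side vanishes in this entry; the right side has (3) as regular part and the y^j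
    -- equations as residues.
    have e := congrFun₂ (hl n z hz0 hz) 1 1
    have eL : ∀ A B : Matrix (Fin 2) (Fin 2) 𝕜,
        (A * L u n z - L u n z * B) 1 1 = A 1 0 * (-u n / z) - B 0 1 := fun A B => by
      rw [Matrix.sub_apply]
      simp [L, Matrix.mul_apply, Fin.sum_univ_two]
    rw [smul_specDeriv_L u n z hz0, eL] at e
    simp [WXT, Matrix.sum_apply] at e
    have e1 : ∑ j, 1 / (z - p.α j) *
          (u n * (y j (n + 1) + y j n) - quad p j n (y j n) / (y j n + y j (n - 1))) =
        (∑ j, (z - p.α j)⁻¹ * (z * (y j (n + 1) + y j n))) * (u n / z) +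
          ∑ j, (z - p.α j)⁻¹ *
            (-((z - p.α j) * y j n) - quad p j n (y j n) / (y j n + y j (n - 1))) +
          ∑ j, y j n := by
      rw [Finset.sum_mul, ← Finset.sum_add_distrib, ← Finset.sum_add_distrib]
      refine Finset.sum_congr rfl fun j _ => ?_
      have := sub_ne_zero.2 (hz j)
      field_simp
      ring
    simp only [neg_mul_eq_neg_mul, neg_sub] at e1
    rw [e1]
    field_simp at e ⊢
    linear_combination e
  refine ⟨fun j n => ?_, fun n => sub_eq_zero.1 (key n).1⟩
  have := (key n).2 j
  rw [sub_eq_zero, eq_div_iff (hne j n)] at this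
  exact this

/-! ### Recovery of the flows from the second Lax equation. -/

section existence

variable {Ω : Set (Fin 2 → 𝕜)} {u : (Fin 2 → 𝕜) → ℤ → 𝕜} {y : (Fin 2 → 𝕜) → Fin m → ℤ → 𝕜}

theorem hasPartialDerivAt_fderiv {r : ℕ} {f : (Fin r → 𝕜) → 𝕜} {Ω : Set (Fin r → 𝕜)}
    (hΩ : IsOpen Ω) (hf : ContDiffOn 𝕜 1 f Ω) {τ : Fin r → 𝕜} (hτ : τ ∈ Ω) (i : Fin r) :
    HasPartialDerivAt f (fderiv 𝕜 f τ (Pi.single i 1)) i τ := by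
  have h1 : HasFDerivAt f (fderiv 𝕜 f τ) (Function.update τ i (τ i)) := by
    rw [Function.update_eq_self]
    exact ((hf.differentiableOn one_ne_zero).differentiableAt (hΩ.mem_nhds hτ)).hasFDerivAt
  exact h1.comp_hasDerivAt (τ i) (hasDerivAt_update τ i (τ i))

/-- The second Lax equation determines the derivatives of `y`, and of `u` outside of `t = 0`. -/
theorem flows_of_lax_snd (hα : Function.Injective p.α) {τ : Fin 2 → 𝕜}
    (hne : ∀ j n, y τ j n + y τ j (n - 1) ≠ 0) (hy : YEquations p (u τ) (y τ))
    (hc : ConstraintXT p (τ 0) (τ 1) (u τ) (y τ)) (i : Fin 2) (n : ℤ) {u' : 𝕜} {y' : Fin m → 𝕜}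
    (hu' : HasPartialDerivAt (fun σ => u σ n) u' i τ)
    (hy' : ∀ j, HasPartialDerivAt (fun σ => y σ j n) (y' j) i τ)
    (hl : ∀ z : 𝕜, z ≠ 0 → (∀ j, z ≠ p.α j) →
      HasPartialDerivAt (fun σ => WXT p (σ 0) (σ 1) (u σ) (y σ) n z 0 0)
        (((2 * z) • specDeriv (fun s => U (i.val + 1) (u τ) n s) z
          + (U (i.val + 1) (u τ) n z * WXT p (τ 0) (τ 1) (u τ) (y τ) n z
            - WXT p (τ 0) (τ 1) (u τ) (y τ) n z * U (i.val + 1) (u τ) n z)) 0 0) i τ) :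
    4 * τ 1 * (u' - flow (u τ) (fun n => h (i.val + 1) n (u τ)) n) = 0 ∧
      ∀ j, y' j - dh (i.val + 1) n (u τ) (flow (u τ) (y τ j)) = 0 := by
  have hc' := constraint_iff_constraintXT.2 hc
  refine eq_zero_of_partialFractions hα fun z hz0 hz => ?_
  have e1 := hl z hz0 hz
  -- The right side involves only values at τ, so the algebraic relations evaluate it without
  -- assuming any flow.
  rw [← commutator_add_smul_one _ _ (1 + p.δ), ← W_eq_WXT_add hc n z hz,
    hc'.lax_rhs hy hne _ n z hz] at e1
  have e2 := (((hasPartialDerivAt_coord i 1 τ).const_mul (4 * z)).mul hu').add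
    (HasDerivAt.fun_sum fun j (_ : j ∈ Finset.univ) =>
      (((hy' j).const_mul z).add_const ((-1) ^ n * (p.β j / 2))).const_mul (1 / (z - p.α j)))
  have e3 := (e2.add_const (- n - 1 - (-1) ^ n * p.ε)).unique
    (HasDerivAt.congr_of_eventuallyEq e1 (Filter.Eventually.of_forall fun s => by
      simp [WXT, Matrix.sum_apply]
      ring))
  have e4 := hc'.sum_dh (i.val + 1) n
  have e5 : z * ∑ j, 1 / (z - p.α j) * (y' j - dh (i.val + 1) n (u τ) (flow (u τ) (y τ j))) =
      ∑ j, 1 / (z - p.α j) * (z * y' j)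
        - ∑ j, 1 / (z - p.α j) * (p.α j * dh (i.val + 1) n (u τ) (flow (u τ) (y τ j)))
        - ∑ j, dh (i.val + 1) n (u τ) (flow (u τ) (y τ j)) := by
    rw [Finset.mul_sum, ← Finset.sum_sub_distrib, ← Finset.sum_sub_distrib]
    refine Finset.sum_congr rfl fun j _ => ?_
    have := sub_ne_zero.2 (hz j)
    field_simp
    ring
  have e6 : ∀ v, UDeriv 1 (u τ) n z v 0 0 = v n := fun v => by
    simp [UDeriv_succ, UDeriv_zero, HDeriv, lenardMatrixDeriv, dh_one]
  have e7 : ∀ v, UDeriv 2 (u τ) n z v 0 0 = z * v n + dh 2 n (u τ) v := fun v => by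
    rw [UDeriv_succ, LinearMap.add_apply, LinearMap.smul_apply, Matrix.add_apply,
      Matrix.smul_apply, e6]
    simp [HDeriv, lenardMatrixDeriv]
  -- The indicator of `1 = i` matches the derivative of the explicit factor t in 4tz u_n.
  have e8 : U (i.val + 1) (u τ) n z 0 0 =
      (if 1 = i then z * u τ n else 0) + h (i.val + 1) n (u τ) := by
    fin_cases i <;> simp [U_succ, U_zero, H, h_one]
  simp only [WDeriv, Fin.sum_univ_two, Fin.val_zero, Fin.val_one, zero_add, Nat.reduceAdd,
    Matrix.add_apply, Matrix.smul_apply, Matrix.sum_apply, smul_eq_mul, WjDeriv,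
    Function.update_eq_self, dh_one, lenardMatrixDeriv, Matrix.of_apply, Matrix.cons_val_zero,
    Matrix.cons_val', Matrix.empty_val', Matrix.cons_val_fin_one, e6, e7, e8] at e3 e4
  apply mul_left_cancel₀ hz0
  rw [mul_add, e5, mul_zero]
  have e9 : ((i.val + 1 : ℕ) : 𝕜) * (if 1 = i then z * u τ n else 0) =
      2 * z * ((if 1 = i then 1 else 0) * u τ n) := by
    fin_cases i
    · simp
    · norm_num; ring
  push_cast at e3 e4 e9
  linear_combination e3 + 2 * e9 + e4

theorem flows_of_lax (hα : Function.Injective p.α) (hΩ : IsOpen Ω)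
    (hu : ∀ n, ContDiffOn 𝕜 1 (fun τ => u τ n) Ω)
    (hyd : ∀ j n, ContDiffOn 𝕜 1 (fun τ => y τ j n) Ω)
    (hne : ∀ τ ∈ Ω, ∀ j n, y τ j n + y τ j (n - 1) ≠ 0)
    (heq : ∀ τ ∈ Ω, YEquations p (u τ) (y τ) ∧ ConstraintXT p (τ 0) (τ 1) (u τ) (y τ))
    (hl : LaxEquations p Ω u (fun τ n z => WXT p (τ 0) (τ 1) (u τ) (y τ) n z)) :
    Flows Ω u y := by
  have key := fun τ hτ i n => flows_of_lax_snd hα (hne τ hτ) (heq τ hτ).1 (heq τ hτ).2 i n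
    (hasPartialDerivAt_fderiv hΩ (hu n) hτ i)
    (fun j => hasPartialDerivAt_fderiv hΩ (hyd j n) hτ i)
    (fun z hz0 hz => (hl τ hτ n z hz0 hz).2 i 0 0)
  intro τ hτ i n
  constructor
  -- The defect g of the u flow is known to vanish only where t ≠ 0. It is continuous since u is C¹,
  -- so approaching along the t-direction gives g = 0 at t = 0 too.
  · set g : (Fin 2 → 𝕜) → 𝕜 := fun σ => fderiv 𝕜 (fun σ => u σ n) σ (Pi.single i 1)
      - flow (u σ) (fun n => h (i.val + 1) n (u σ)) n with hg
    have hU : ContinuousOn u Ω := continuousOn_pi.2 fun n => (hu n).continuousOn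
    have hcont : ContinuousOn g Ω := by
      have h1 := ((hu n).continuousOn_fderiv_of_isOpen hΩ le_rfl).clm_apply
        (continuousOn_const (c := Pi.single i (1 : 𝕜)))
      have h2 := fun k => (MvPolynomial.continuous_eval (hPoly 𝕜 (i.val + 1) k)).comp_continuousOn hU
      exact h1.sub ((hu n).continuousOn.mul ((h2 (n + 1)).sub (h2 (n - 1))))
    have hg0 : ∀ σ ∈ Ω, σ 1 ≠ 0 → g σ = 0 := fun σ hσ h1 => by
      have := (key σ hσ i n).1
      simpa [h1] using this
    have hc : Filter.Tendsto (fun s => Function.update τ 1 s) (nhds (τ 1)) (nhds τ) := by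
      have : Continuous fun s => Function.update τ 1 s := by fun_prop
      simpa using this.tendsto (τ 1)
    have hlim := ((hcont.continuousAt (hΩ.mem_nhds hτ)).tendsto.comp hc).mono_left
      (nhdsWithin_le_nhds (s := {τ 1}ᶜ))
    have hzero : Filter.Tendsto (g ∘ fun s => Function.update τ 1 s)
        (nhdsWithin (τ 1) {τ 1}ᶜ) (nhds 0) := by
      refine tendsto_const_nhds.congr' ?_
      filter_upwards [eventually_ne_nhdsNE (τ 1) 0,
        nhdsWithin_le_nhds (hc (hΩ.mem_nhds hτ))] with s hs hsΩ
      exact (hg0 _ hsΩ (by simpa using hs)).symm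
    have h0 := sub_eq_zero.1 (tendsto_nhds_unique hlim hzero)
    exact (hasPartialDerivAt_fderiv hΩ (hu n) hτ i).congr_deriv h0
  · intro j
    rw [hXi_eq_dh]
    exact (hasPartialDerivAt_fderiv hΩ (hyd j n) hτ i).congr_deriv
      (sub_eq_zero.1 ((key τ hτ i n).2 j))

end existence

end Volterra

end

theorem proposition5 {𝕜 : Type*} [RCLike 𝕜] {m : ℕ} (p : Volterra.Params 𝕜 m) :
    -- the matrix relations hold on solutions of the system and of the flows
    (∀ (r : ℕ) (Ω : Set (Fin r → 𝕜)) (u : (Fin r → 𝕜) → ℤ → 𝕜)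
        (y : (Fin r → 𝕜) → Fin m → ℤ → 𝕜),
      IsOpen Ω →
      (∀ τ ∈ Ω, ∀ (j : Fin m) (n : ℤ), y τ j n + y τ j (n - 1) ≠ 0) →
      (∀ τ ∈ Ω, Volterra.YEquations p (u τ) (y τ) ∧ Volterra.Constraint p τ (u τ) (y τ)) →
      Volterra.Flows Ω u y →
      Volterra.LaxEquations p Ω u (fun τ n z => Volterra.W p τ (u τ) (y τ) n z))
    ∧
    -- for `r = 2`, elimination by the last equation gives the second matrix, up to a scalar matrix
    (∀ (τ : Fin 2 → 𝕜) (u : ℤ → 𝕜) (y : Fin m → ℤ → 𝕜),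
      Volterra.ConstraintXT p (τ 0) (τ 1) u y →
      ∀ (n : ℤ) (z : 𝕜), (∀ j, z ≠ p.α j) →
        Volterra.W p τ u y n z
          = Volterra.WXT p (τ 0) (τ 1) u y n z + (1 + p.δ) • (1 : Matrix (Fin 2) (Fin 2) 𝕜))
    ∧
    -- for `r = 2`, the matrix equations are equivalent to the system and its two flows
    (Function.Injective p.α →
      ∀ (Ω : Set (Fin 2 → 𝕜)) (u : (Fin 2 → 𝕜) → ℤ → 𝕜)
        (y : (Fin 2 → 𝕜) → Fin m → ℤ → 𝕜),
      IsOpen Ω →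
      (∀ n : ℤ, ContDiffOn 𝕜 1 (fun τ => u τ n) Ω) →
      (∀ (j : Fin m) (n : ℤ), ContDiffOn 𝕜 1 (fun τ => y τ j n) Ω) →
      (∀ τ ∈ Ω, ∀ (j : Fin m) (n : ℤ), y τ j n + y τ j (n - 1) ≠ 0) →
      (Volterra.LaxEquations p Ω u (fun τ n z => Volterra.WXT p (τ 0) (τ 1) (u τ) (y τ) n z)
        ↔ (∀ τ ∈ Ω, Volterra.YEquations p (u τ) (y τ)
              ∧ Volterra.ConstraintXT p (τ 0) (τ 1) (u τ) (y τ))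
          ∧ Volterra.FlowsXT Ω u y)) := by
  refine ⟨fun r Ω u y hΩ hne heq hfl => Volterra.laxEquations_W hΩ hne heq hfl,
    fun τ u y hc n z hz => Volterra.W_eq_WXT_add hc n z hz,
    fun hα Ω u y hΩ hu hyd hne => ⟨fun hl => ?_, fun ⟨heq, hfl⟩ => ?_⟩⟩
  · have heq := fun τ hτ => Volterra.equations_of_lax_fst hα (hne τ hτ)
      (fun n z hz0 hz => (hl τ hτ n z hz0 hz).1)
    exact ⟨heq, Volterra.flows_iff_flowsXT.1
      (Volterra.flows_of_lax hα hΩ hu hyd hne heq hl)⟩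
  · have hW := Volterra.laxEquations_W hΩ hne
      (fun τ hτ => ⟨(heq τ hτ).1, Volterra.constraint_iff_constraintXT.2 (heq τ hτ).2⟩)
      (Volterra.flows_iff_flowsXT.2 hfl)
    exact hW.of_add_smul_one hΩ fun τ hτ n z hz => Volterra.W_eq_WXT_add (heq τ hτ).2 n z hz
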